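/- **Riemann surface laminations.** Let $\mathbb D\subset\mathbb C$ be the open unit disc. A Riemann surface lamination is a topological space $X$ with an open cover $\{U_\alpha\}$ and homeomorphisms $\phi_\alpha=(z_\alpha,t_\alpha):U_\alpha\to\mathbb D\times T_\alpha$, where each $T_\alpha$ is a metrizable space, such that the maps $\phi_\beta\circ\phi_\alpha^{-1}$ have locally the form $(z_\alpha,t_\alpha)\mapsto(z_{\beta\alpha}(z_\alpha,t_\alpha),t_{\beta\alpha}(t_\alpha))$ with $z_{\beta\alpha}$ holomorphic in $z_\alpha$ for fixed $t_\alpha$. The sets $\phi_\alpha^{-1}(\mathbb D\times\{t\})$ are called plaques. A leaf is a minimal nonempty subset of $X$ that contains every plaque passing through one of its points; $\mathcal L_x$ denotes the leaf through $x$. A leaf carries the topology generated by its plaques and its intersections with open subsets of $X$, and the complex structure given by the coordinates $z_\alpha$ on its plaques. Let $\|\cdot\|_X$ be a hermitian metric along the leaves of $X$ that is continuous on $X$, that is, the length of $\partial/\partial z_\alpha$ is a positive continuous function on $U_\alpha$ for each $\alpha$. For $x\in X$ let $\mathcal F_x$ be the set of holomorphic maps $f:\mathbb D\to\mathcal L_x$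 with $f(0)=x$. The leafwise Kobayashi metric is $$K_X(x)=\Bigl[\sup_{f\in\mathcal F_x}\|f'(0)\|_X\Bigr]^{-1},\qquad \tfrac1\infty=0.$$ **Theorem.** For every Riemann surface lamination $X$ with such a metric $\|\cdot\|_X$, the function $K_X$ takes values in $[0,\infty)$ and is upper semicontinuous on $X$. -/

import Mathlib

open Set Filter Topology Metric
open scoped ENNReal

set_option linter.checkUnivs false

universe u v w

/-- A Riemann surface lamination structure on a topological space `X`: an open cover by flow boxes
`(box a).source`, each with a homeomorphism `box a` onto (open unit disc) `× T a`, where `T a` is a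
metrizable space, such that every change of flow boxes is locally of the form
`(z, t) ↦ (z'(z, t), t'(t))` with `z'` holomorphic in `z` for fixed `t`. -/
structure RiemannSurfaceLamination (X : Type u) [TopologicalSpace X] where
  ι : Type v
  T : ι → Type w
  topT : ∀ a, TopologicalSpace (T a)
  metrizableT : ∀ a, TopologicalSpace.MetrizableSpace (T a)
  box : ∀ a, OpenPartialHomeomorph X (ℂ × T a)
  box_target : ∀ a, (box a).target = ball (0 : ℂ) 1 ×ˢ (univ : Set (T a))
  cover : ∀ x : X, ∃ a, x ∈ (box a).source
  compat : ∀ a b, ∀ p ∈ ((box a).symm.trans (box b)).source, ∃ τ : T a → T b, ∀ᶠ q in 𝓝 p,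
    (box b ((box a).symm q)).2 = τ q.2 ∧
      DifferentiableAt ℂ (fun z : ℂ => (box b ((box a).symm (z, q.2))).1) q.1

namespace RiemannSurfaceLamination

attribute [instance] RiemannSurfaceLamination.topT RiemannSurfaceLamination.metrizableT

variable {X : Type u} [TopologicalSpace X] (L : RiemannSurfaceLamination.{u, v, w} X)

/-- The plaque `{t_a = t}` of the flow box `a`. -/
def plaque (a : L.ι) (t : L.T a) : Set X :=
  {x | x ∈ (L.box a).source ∧ (L.box a x).2 = t}

/-- `S` contains every plaque that passes through one of its points. -/
def IsSaturated (S : Set X) : Prop :=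
  ∀ x ∈ S, ∀ a, x ∈ (L.box a).source → L.plaque a (L.box a x).2 ⊆ S

/-- A leaf is a minimal nonempty saturated set. -/
def IsLeaf (S : Set X) : Prop :=
  Minimal (fun S : Set X => S.Nonempty ∧ L.IsSaturated S) S

/-- The leaf through `x`: the smallest saturated set that contains `x`. -/
def leaf (x : X) : Set X := ⋂₀ {S | L.IsSaturated S ∧ x ∈ S}

theorem mem_leaf (x : X) : x ∈ L.leaf x := fun _ hS => hS.2

theorem isSaturated_leaf (x : X) : L.IsSaturated (L.leaf x) :=
  fun y hy a ha _ hz S hS => hS.1 y (hy S hS) a ha hz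

theorem IsSaturated.compl {L : RiemannSurfaceLamination.{u, v, w} X} {S : Set X}
    (hS : L.IsSaturated S) : L.IsSaturated Sᶜ :=
  fun _ hx a ha y hy hyS => hx (hS y hyS a hy.1 ⟨ha, hy.2.symm⟩)

/-- `L.leaf x` is a leaf, and it is the only leaf that contains `x`. -/
theorem isLeaf_iff_of_mem {x : X} {S : Set X} (hx : x ∈ S) : L.IsLeaf S ↔ S = L.leaf x := by
  constructor
  · intro h
    have h1 : L.leaf x ⊆ S := fun y hy => hy S ⟨h.prop.2, hx⟩
    exact Subset.antisymm (h.le_of_le ⟨⟨x, L.mem_leaf x⟩, L.isSaturated_leaf x⟩ h1) h1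
  · rintro rfl
    refine ⟨⟨⟨x, hx⟩, L.isSaturated_leaf x⟩, fun S hS hSx y hy => ?_⟩
    by_cases hxS : x ∈ S
    · exact hy S ⟨hS.2, hxS⟩
    · obtain ⟨s, hs⟩ := hS.1
      exact absurd hs (hSx hs Sᶜ ⟨hS.2.compl, hxS⟩)

/-- The leaf topology, on all leaves at once: it is generated by the plaques and by the open
subsets of `X`. Every leaf is open in it, and the topology of a single leaf, generated by the
plaques in the leaf and by the intersections of the leaf with the open subsets of `X`, is the
subspace topology of this one. -/
@[reducible]
def leafTopology : TopologicalSpace X :=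
  TopologicalSpace.generateFrom ({P | ∃ a t, P = L.plaque a t} ∪ {U | IsOpen U})

/-- `f`, restricted to the open unit disc, is a holomorphic map from the disc to the leaf through
`x`: it takes values in the leaf, is continuous for the leaf topology, and is holomorphic when
read in the coordinates `z_a` of the leaf. The values of `f` outside the disc are irrelevant. -/
structure IsHolomorphicDisc (x : X) (f : ℂ → X) : Prop where
  mapsTo : MapsTo f (ball 0 1) (L.leaf x)
  continuousOn : @ContinuousOn ℂ X _ L.leafTopology f (ball 0 1)
  differentiableAt : ∀ a, ∀ ζ ∈ ball (0 : ℂ) 1, f ζ ∈ (L.box a).source →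
    DifferentiableAt ℂ (fun w => (L.box a (f w)).1) ζ

/-- The family of holomorphic maps `f` from the unit disc to the leaf through `x`
with `f 0 = x`. -/
def discs (x : X) : Set (ℂ → X) := {f | L.IsHolomorphicDisc x f ∧ f 0 = x}

/-- The derivative `∂z_b / ∂z_a` along the leaf, at the point `x`. -/
noncomputable def transitionDeriv (a b : L.ι) (x : X) : ℂ :=
  deriv (fun z : ℂ => (L.box b ((L.box a).symm (z, (L.box a x).2))).1) (L.box a x).1

/-- A hermitian metric along the leaves, continuous on `X`. It is given in each flow box by
`density a x`, the length of the tangent vector `∂/∂z_a` at `x`, which is positive and continuous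
on the flow box (also transversally) and transforms as the length of a tangent vector does. -/
structure LeafMetric where
  density : L.ι → X → ℝ
  density_pos : ∀ a, ∀ x ∈ (L.box a).source, 0 < density a x
  continuousOn : ∀ a, ContinuousOn (density a) (L.box a).source
  density_eq : ∀ a b, ∀ x ∈ (L.box a).source ∩ (L.box b).source,
    density a x = ‖L.transitionDeriv a b x‖ * density b x

namespace LeafMetric

variable {L} (g : L.LeafMetric)

/-- The length of the tangent vector `f'(ζ)`, computed in some flow box that contains `f ζ`. -/
noncomputable def speed (f : ℂ → X) (ζ : ℂ) : ℝ :=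
  ‖deriv (fun w => (L.box (L.cover (f ζ)).choose (f w)).1) ζ‖ *
    g.density (L.cover (f ζ)).choose (f ζ)

/-- The length of `f'(ζ)` does not depend on the flow box. -/
theorem speed_eq {x : X} {f : ℂ → X} (hf : L.IsHolomorphicDisc x f) {ζ : ℂ}
    (hζ : ζ ∈ ball (0 : ℂ) 1) {b : L.ι} (hb : f ζ ∈ (L.box b).source) :
    g.speed f ζ = ‖deriv (fun w => (L.box b (f w)).1) ζ‖ * g.density b (f ζ) := by
  unfold speed
  have ha := (L.cover (f ζ)).choose_spec
  generalize (L.cover (f ζ)).choose = a at ha ⊢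
  rw [g.density_eq a b (f ζ) ⟨ha, hb⟩, ← mul_assoc, ← norm_mul]
  congr 2
  have hP : ∀ᶠ w in 𝓝 ζ, f w ∈ L.plaque a (L.box a (f ζ)).2 := by
    have hc : @ContinuousAt ℂ X _ L.leafTopology f ζ :=
      @ContinuousOn.continuousAt ℂ X _ L.leafTopology f _ ζ hf.continuousOn
        (isOpen_ball.mem_nhds hζ)
    have ho : IsOpen[L.leafTopology] (L.plaque a (L.box a (f ζ)).2) :=
      TopologicalSpace.isOpen_generateFrom_of_mem (Or.inl ⟨a, _, rfl⟩)
    exact hc (@IsOpen.mem_nhds X L.leafTopology _ _ ho ⟨ha, rfl⟩)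
  obtain ⟨τ, hτ⟩ := L.compat a b (L.box a (f ζ)) (by
    simp [(L.box a).map_source ha, (L.box a).left_inv ha, hb])
  have hd := hτ.self_of_nhds.2
  have heq : (fun w => (L.box b (f w)).1) =ᶠ[𝓝 ζ]
      (fun z : ℂ => (L.box b ((L.box a).symm (z, (L.box a (f ζ)).2))).1) ∘
        (fun w => (L.box a (f w)).1) := by
    filter_upwards [hP] with w hw
    have : ((L.box a (f w)).1, (L.box a (f ζ)).2) = L.box a (f w) := Prod.ext rfl hw.2.symm
    simp only [Function.comp, this, (L.box a).left_inv hw.1]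
  rw [heq.deriv_eq, deriv_comp ζ hd (hf.differentiableAt a ζ hζ ha), mul_comm]
  rfl

/-- The leafwise Kobayashi metric: the inverse of the supremum of the lengths of `f'(0)`, over the
holomorphic discs `f` in the leaf through `x` with `f 0 = x` (so `0` if these are unbounded). -/
noncomputable def kobayashi (x : X) : ℝ≥0∞ :=
  (⨆ f ∈ L.discs x, ENNReal.ofReal (g.speed f 0))⁻¹

end LeafMetric

end RiemannSurfaceLamination

/-! Finiteness holds because a flow box already contains a disc of positive speed. Upper
semicontinuity amounts to persistence of discs: if a disc `f` through `x` has speed greater than `s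
≥ 0`, then every point `y` near `x` is the centre of a disc of speed greater than `s` in its own
leaf (`eventually_exists_disc_lt_speed`). Such an `f` is not critical at `0`. It suffices to deform
`f`, over a slightly smaller closed disc, to maps `h y` into the leaves of nearby points that
converge to `f` uniformly (`deforms_disc`). A Hurwitz argument (`exists_eq_of_close`) then finds `ξ`
near `0` with `h y ξ = y`. The disc `z ↦ h y (ξ + r * z)`, with `r < 1` close to `1`, is centred at
`y` and loses arbitrarily little speed.

Inside one flow box the deformation is trivial: keep the coordinate `z_a` of `f` and change the
plaque. The difficulty is to glue local deformations (`Deforms.union`). Suppose that `h y` is given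
near `K₁` and that `f` maps `K₂` into one plaque, with coordinate `F`. On the overlap let `Φ` be the
coordinate of `h y`, which is close to `F`. One looks for small holomorphic `a` near `K₁` and `b`
near `K₂` with `F + F' b = Φ ∘ (id + a)` on the overlap. Then `h y ∘ (id + a)` and the map with
coordinate `F + F' b` in the plaque of `h y` agree there. To first order this is the additive Cousin
problem `a - b = (F - Φ) / F'`. The additive problem is solved with sup-norm bounds by a cutoff
function and the Cauchy transform (`exists_splitting`), and the nonlinear one follows by contraction
(`exists_nonlinear_splitting`).

The gluing needs an overlap that is connected, so that `h y` stays in one plaque there, and free of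
critical points of `f`, so that one can divide by `F'`. The unit disc is therefore replaced by a
conformally equivalent strip, and a rectangle in it is filled by small cells. Each overlap is a
point or a pair of adjacent edges. Since `f` has only countably many critical points, these edges
can be placed on lines that avoid them (`deforms_rectangle`). -/

/-! ### The Cauchy transform and the Cauchy–Pompeiu formula. -/

section CauchyTransform

open MeasureTheory

/-- The Wirtinger derivative `∂φ/∂z̄`. -/
noncomputable def dbar (φ : ℂ → ℂ) (z : ℂ) : ℂ :=
  (fderiv ℝ φ z 1 + Complex.I * fderiv ℝ φ z Complex.I) / 2

/-- The solid Cauchy transform `(1/π) ∫ g(ζ) / (z - ζ)` of `g`. -/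
noncomputable def cauchyTransform (g : ℂ → ℂ) (z : ℂ) : ℂ :=
  (Real.pi : ℂ)⁻¹ * ∫ ζ, g ζ / (z - ζ)

/-- In polar coordinates the Jacobian `r` cancels the singularity `1 / r`, so the integral is at
most the area of a bounded rectangle. -/
theorem integrableOn_norm_inv_ball (R : ℝ) :
    IntegrableOn (fun ζ : ℂ => ‖ζ‖⁻¹) (ball 0 R) := by
  refine ⟨(measurable_norm.inv).aestronglyMeasurable, ?_⟩
  rw [HasFiniteIntegral, ← lintegral_indicator measurableSet_ball,
    ← Complex.lintegral_comp_polarCoord_symm, polarCoord_target]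
  calc _ ≤ ∫⁻ p in Ioi (0 : ℝ) ×ˢ Ioo (-Real.pi) Real.pi,
        (Ioo (0 : ℝ) R ×ˢ Ioo (-Real.pi) Real.pi).indicator 1 p := by
        refine setLIntegral_mono (measurable_one.indicator
          (measurableSet_Ioo.prod measurableSet_Ioo)) ?_
        rintro ⟨r, θ⟩ ⟨hr, hθ⟩
        have hr : 0 < r := hr
        have hn : ‖Complex.polarCoord.symm (r, θ)‖ = r := by
          rw [Complex.norm_polarCoord_symm, abs_of_pos hr]
        by_cases h : r < R
        · rw [indicator_of_mem (by rwa [mem_ball_zero_iff, hn]),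
            indicator_of_mem (by exact ⟨⟨hr, h⟩, hθ⟩), hn]
          simp only [smul_eq_mul, Pi.one_apply]
          rw [Real.enorm_eq_ofReal (by positivity), ← ENNReal.ofReal_mul hr.le,
            mul_inv_cancel₀ hr.ne', ENNReal.ofReal_one]
        · rw [indicator_of_notMem (by rwa [mem_ball_zero_iff, hn])]
          simp
    _ ≤ ∫⁻ p : ℝ × ℝ, (Ioo (0 : ℝ) R ×ˢ Ioo (-Real.pi) Real.pi).indicator 1 p :=
        setLIntegral_le_lintegral _ _
    _ = volume (Ioo (0 : ℝ) R ×ˢ Ioo (-Real.pi) Real.pi) :=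
        lintegral_indicator_one (measurableSet_Ioo.prod measurableSet_Ioo)
    _ < ⊤ := by
        rw [Measure.volume_eq_prod, Measure.prod_prod]
        exact ENNReal.mul_lt_top (by simp) (by simp)

theorem integrableOn_norm_sub_inv_ball (R : ℝ) (z : ℂ) :
    IntegrableOn (fun ζ : ℂ => ‖z - ζ‖⁻¹) (ball z R) := by
  have h := (integrableOn_norm_inv_ball R)
  rw [← integrable_indicator_iff measurableSet_ball] at h ⊢
  refine (h.comp_sub_right z).congr (Eventually.of_forall fun ζ => ?_)
  simp only [indicator, mem_ball, dist_eq_norm, norm_sub_rev z ζ, sub_zero]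

theorem integral_norm_sub_inv_ball (R : ℝ) (z : ℂ) :
    ∫ ζ in ball z R, ‖z - ζ‖⁻¹ = ∫ ζ in ball (0 : ℂ) R, ‖ζ‖⁻¹ := by
  rw [← integral_indicator measurableSet_ball, ← integral_indicator measurableSet_ball,
    ← integral_sub_right_eq_self ((ball (0 : ℂ) R).indicator fun ζ => ‖ζ‖⁻¹) z]
  refine integral_congr_ae (Eventually.of_forall fun ζ => ?_)
  simp only [indicator, mem_ball, dist_eq_norm, norm_sub_rev z ζ, sub_zero]

/-- The ball of radius `R` about `0` lies in the ball of radius `2 * R` about each of its points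
`z`. The majorant is thus a translate of one fixed kernel, and its integral does not depend on `z`.
-/
theorem norm_div_sub_le {g : ℂ → ℂ} {M R : ℝ} (hM : ∀ ζ, ‖g ζ‖ ≤ M)
    (hsupp : ∀ ζ ∉ ball (0 : ℂ) R, g ζ = 0) {z : ℂ} (hz : z ∈ ball (0 : ℂ) R) (ζ : ℂ) :
    ‖g ζ / (z - ζ)‖ ≤ (ball z (2 * R)).indicator (fun ζ => M * ‖z - ζ‖⁻¹) ζ := by
  by_cases h : ζ ∈ ball (0 : ℂ) R
  · rw [indicator_of_mem, norm_div, div_eq_mul_inv]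
    · exact mul_le_mul_of_nonneg_right (hM ζ) (by positivity)
    · rw [mem_ball, dist_eq_norm]
      rw [mem_ball_zero_iff] at h hz
      linarith [norm_sub_le ζ z]
  · rw [hsupp ζ h]
    simp only [zero_div, norm_zero]
    exact indicator_nonneg (fun _ _ => mul_nonneg ((norm_nonneg _).trans (hM 0)) (by positivity)) _

theorem integrable_div_sub {g : ℂ → ℂ} {M R : ℝ} (hg : AEStronglyMeasurable g)
    (hM : ∀ ζ, ‖g ζ‖ ≤ M) (hsupp : ∀ ζ ∉ ball (0 : ℂ) R, g ζ = 0) {z : ℂ}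
    (hz : z ∈ ball (0 : ℂ) R) : Integrable (fun ζ => g ζ / (z - ζ)) := by
  refine Integrable.mono' (g := (ball z (2 * R)).indicator (fun ζ => M * ‖z - ζ‖⁻¹)) ?_ ?_
    (Eventually.of_forall (norm_div_sub_le hM hsupp hz))
  · rw [integrable_indicator_iff measurableSet_ball]
    exact (integrableOn_norm_sub_inv_ball _ z).const_mul M
  · exact (hg.aemeasurable.div (by fun_prop)).aestronglyMeasurable

theorem norm_cauchyTransform_le {g : ℂ → ℂ} {M R : ℝ}
    (hM : ∀ ζ, ‖g ζ‖ ≤ M) (hsupp : ∀ ζ ∉ ball (0 : ℂ) R, g ζ = 0) {z : ℂ}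
    (hz : z ∈ ball (0 : ℂ) R) :
    ‖cauchyTransform g z‖ ≤ (Real.pi⁻¹ * ∫ ζ in ball (0 : ℂ) (2 * R), ‖ζ‖⁻¹) * M := by
  rw [cauchyTransform, norm_mul, mul_assoc]
  have h1 : ‖(Real.pi : ℂ)⁻¹‖ = Real.pi⁻¹ := by
    rw [norm_inv, Complex.norm_real, Real.norm_of_nonneg Real.pi_pos.le]
  rw [h1]
  refine mul_le_mul_of_nonneg_left ?_ (by positivity)
  refine (norm_integral_le_of_norm_le (g := (ball z (2 * R)).indicator (fun ζ => M * ‖z - ζ‖⁻¹))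
    ?_ (Eventually.of_forall (norm_div_sub_le hM hsupp hz))).trans (le_of_eq ?_)
  · rw [integrable_indicator_iff measurableSet_ball]
    exact (integrableOn_norm_sub_inv_ball _ z).const_mul M
  · rw [integral_indicator measurableSet_ball, integral_const_mul, integral_norm_sub_inv_ball,
      mul_comm]

theorem cauchyTransform_sub {g g' : ℂ → ℂ} {z : ℂ} (hg : Integrable (fun ζ => g ζ / (z - ζ)))
    (hg' : Integrable (fun ζ => g' ζ / (z - ζ))) :
    cauchyTransform (fun ζ => g ζ - g' ζ) z = cauchyTransform g z - cauchyTransform g' z := by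
  simp only [cauchyTransform, sub_div, integral_sub hg hg', mul_sub]

/-- The Cauchy transform is holomorphic off the support. -/
theorem differentiableAt_cauchyTransform {g : ℂ → ℂ} (hg : Integrable g) {z : ℂ}
    (hz : ∀ᶠ ζ in 𝓝 z, g ζ = 0) : DifferentiableAt ℂ (cauchyTransform g) z := by
  obtain ⟨ε, hε, hb⟩ := Metric.eventually_nhds_iff_ball.1 hz
  have hfar : ∀ ζ, g ζ ≠ 0 → ∀ w ∈ ball z (ε / 2), ε / 2 ≤ ‖w - ζ‖ := by
    intro ζ hζ w hw
    by_contra! h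
    refine hζ (hb ζ ?_)
    rw [mem_ball] at hw ⊢
    rw [← dist_eq_norm, dist_comm] at h
    linarith [dist_triangle ζ w z]
  have key := (hasDerivAt_integral_of_dominated_loc_of_deriv_le (μ := volume)
    (F := fun w ζ => g ζ / (w - ζ)) (F' := fun w ζ => - g ζ / (w - ζ) ^ 2) (x₀ := z)
    (s := ball z (ε / 2)) (bound := fun ζ => ‖g ζ‖ / (ε / 2) ^ 2)
    (ball_mem_nhds z (half_pos hε)) ?_ ?_ ?_ ?_ ?_ ?_).2
  · exact (key.differentiableAt).const_mul _
  · exact Eventually.of_forall fun w =>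
      (hg.aestronglyMeasurable.aemeasurable.div (by fun_prop)).aestronglyMeasurable
  · refine Integrable.mono' (g := fun ζ => ‖g ζ‖ / (ε / 2)) (hg.norm.div_const _)
      (hg.aestronglyMeasurable.aemeasurable.div (by fun_prop)).aestronglyMeasurable
      (Eventually.of_forall fun ζ => ?_)
    by_cases h : g ζ = 0
    · simp [h]
    · rw [norm_div]
      have := hfar ζ h z (mem_ball_self (half_pos hε))
      gcongr
  · exact (hg.aestronglyMeasurable.aemeasurable.neg.div (by fun_prop)).aestronglyMeasurable
  · refine Eventually.of_forall fun ζ w hw => ?_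
    by_cases h : g ζ = 0
    · simp [h]
    · rw [norm_div, norm_neg, norm_pow]
      have := hfar ζ h w hw
      gcongr
  · exact hg.norm.div_const _
  · refine Eventually.of_forall fun ζ w hw => ?_
    by_cases h : g ζ = 0
    · simp [h, hasDerivAt_const]
    · have hne : w - ζ ≠ 0 := by
        rw [← norm_pos_iff]
        exact (half_pos hε).trans_le (hfar ζ h w hw)
      simpa using (hasDerivAt_const w (g ζ)).fun_div ((hasDerivAt_id w).sub_const ζ) hne

/-- In polar coordinates `r ∂̄φ / ζ = (∂φ/∂r + (i / r) ∂φ/∂θ) / 2`. The radial term integrates to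
`-φ 0` along each ray, and the angular term to zero along each circle. -/
theorem integral_dbar_div {φ : ℂ → ℂ} (hφ : ContDiff ℝ 1 φ) (hs : HasCompactSupport φ) :
    ∫ ζ, dbar φ ζ / ζ = - Real.pi * φ 0 := by
  obtain ⟨R, hR⟩ := hs.isCompact.isBounded.subset_ball 0
  have hD : Continuous (fderiv ℝ φ) := hφ.continuous_fderiv one_ne_zero
  have hD0 : ∀ ζ : ℂ, R ≤ ‖ζ‖ → fderiv ℝ φ ζ = 0 := by
    intro ζ hζ
    have : ζ ∉ tsupport φ := fun h => by
      have := hR h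
      rw [mem_ball_zero_iff] at this
      linarith
    have h2 : ζ ∉ tsupport (fderiv ℝ φ) := fun h => this (tsupport_fderiv_subset ℝ h)
    exact image_eq_zero_of_notMem_tsupport h2
  set e : ℝ → ℂ := fun θ => Real.cos θ + Real.sin θ * Complex.I with he
  have hec : Continuous e := by fun_prop
  have hen : ∀ θ, ‖e θ‖ = 1 := fun θ => by
    have := Complex.norm_polarCoord_symm (1, θ)
    simpa only [Complex.polarCoord_symm_apply, Complex.ofReal_one, one_mul, abs_one] using this
  have hne : ∀ (r : ℝ) θ, 0 < r → ‖(r : ℂ) * e θ‖ = r := fun r θ hr => by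
    rw [norm_mul, hen, mul_one, Complex.norm_real, Real.norm_of_nonneg hr.le]
  set T : Set (ℝ × ℝ) := Ioi (0 : ℝ) ×ˢ Ioo (-Real.pi) Real.pi with hT
  have hint : ∀ k : ℝ → ℂ, Continuous k →
      IntegrableOn (fun p : ℝ × ℝ => fderiv ℝ φ (p.1 * e p.2) (k p.2)) T := by
    intro k hk
    have hc : Continuous (fun p : ℝ × ℝ => fderiv ℝ φ (p.1 * e p.2) (k p.2)) :=
      (hD.comp (by fun_prop)).clm_apply (by fun_prop)
    have h1 : IntegrableOn (fun p : ℝ × ℝ => fderiv ℝ φ (p.1 * e p.2) (k p.2))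
        (Icc 0 R ×ˢ Icc (-Real.pi) Real.pi) :=
      hc.continuousOn.integrableOn_compact (isCompact_Icc.prod isCompact_Icc)
    refine h1.of_forall_sdiff_eq_zero (measurableSet_Ioi.prod measurableSet_Ioo) ?_
    rintro ⟨r, θ⟩ ⟨⟨hr, hθ⟩, hn⟩
    have hr' : R ≤ r := by
      by_contra! h
      exact hn ⟨⟨le_of_lt hr, h.le⟩, Ioo_subset_Icc_self hθ⟩
    have := hD0 (r * e θ) (by rw [hne r θ hr]; exact hr')
    simp [this]
  have hie : Continuous fun θ => Complex.I * e θ := by fun_prop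
  rw [← Complex.integral_comp_polarCoord_symm, polarCoord_target]
  have h1 : ∫ p in T, p.1 • (dbar φ (Complex.polarCoord.symm p) / Complex.polarCoord.symm p) =
      ∫ p in T, ((1 / 2 : ℂ) * fderiv ℝ φ (p.1 * e p.2) (e p.2) +
        (Complex.I / 2) * fderiv ℝ φ (p.1 * e p.2) (Complex.I * e p.2)) := by
    refine setIntegral_congr_fun (measurableSet_Ioi.prod measurableSet_Ioo) ?_
    rintro ⟨r, θ⟩ ⟨hr, -⟩
    have hr0 : (r : ℂ) ≠ 0 := by exact_mod_cast (ne_of_gt hr)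
    have he0 : e θ ≠ 0 := by
      rw [← norm_pos_iff, hen]; exact one_pos
    have hsq : (Real.cos θ : ℂ) ^ 2 + (Real.sin θ : ℂ) ^ 2 = 1 := by
      exact_mod_cast Real.cos_sq_add_sin_sq θ
    simp only [Complex.polarCoord_symm_apply]
    change r • (dbar φ (r * e θ) / (r * e θ)) = _
    have e1 : e θ = Real.cos θ • (1 : ℂ) + Real.sin θ • Complex.I := by
      simp [he]
    have e2 : Complex.I * e θ = Real.cos θ • Complex.I - Real.sin θ • (1 : ℂ) := by
      simp only [he, mul_add, Complex.real_smul]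
      linear_combination (Real.sin θ : ℂ) * Complex.I_mul_I
    have e3 : fderiv ℝ φ (r * e θ) (e θ) = Real.cos θ • fderiv ℝ φ (r * e θ) 1 +
        Real.sin θ • fderiv ℝ φ (r * e θ) Complex.I := by
      rw [← (fderiv ℝ φ (r * e θ)).map_smul, ← (fderiv ℝ φ (r * e θ)).map_smul, ← map_add, ← e1]
    have e4 : fderiv ℝ φ (r * e θ) (Complex.I * e θ) =
        Real.cos θ • fderiv ℝ φ (r * e θ) Complex.I -
        Real.sin θ • fderiv ℝ φ (r * e θ) 1 := by
      rw [e2, map_sub, (fderiv ℝ φ (r * e θ)).map_smul, (fderiv ℝ φ (r * e θ)).map_smul]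
    rw [e3, e4, dbar]
    simp only [Complex.real_smul]
    generalize fderiv ℝ φ (r * e θ) 1 = P
    generalize fderiv ℝ φ (r * e θ) Complex.I = Q
    have hinv : (e θ)⁻¹ = Real.cos θ - Real.sin θ * Complex.I := by
      refine inv_eq_of_mul_eq_one_right ?_
      simp only [he]
      linear_combination hsq - (Real.sin θ : ℂ) ^ 2 * Complex.I_mul_I
    rw [mul_comm (r : ℂ) (e θ), div_mul_eq_div_div, mul_div_cancel₀ _ hr0, div_eq_mul_inv _ (e θ), hinv]
    linear_combination (-(Real.sin θ : ℂ) * Q / 2) * Complex.I_mul_I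
  rw [h1, integral_add ((hint e hec).const_mul _) ((hint _ hie).const_mul _),
    integral_const_mul, integral_const_mul]
  have hu : ∫ p in T, fderiv ℝ φ (p.1 * e p.2) (e p.2) = - (2 * Real.pi) * φ 0 := by
    have hi := hint e hec
    rw [hT, Measure.volume_eq_prod] at hi ⊢
    rw [← setIntegral_prod_swap]
    refine (setIntegral_prod _ hi.swap).trans ?_
    have : ∀ θ : ℝ, ∫ r in Ioi (0 : ℝ), fderiv ℝ φ (r * e θ) (e θ) = - φ 0 := by
      intro θ
      have hd : ∀ r : ℝ, HasDerivAt (fun r : ℝ => φ (r * e θ)) (fderiv ℝ φ (r * e θ) (e θ)) r := by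
        intro r
        have h2 : HasDerivAt (fun r : ℝ => (r : ℂ) * e θ) (e θ) r := by
          simpa using (Complex.ofRealCLM.hasDerivAt (x := r)).mul_const (e θ)
        exact (hφ.differentiable one_ne_zero _).hasFDerivAt.comp_hasDerivAt r h2
      have hz : ∀ r : ℝ, R ≤ r → 0 < r → φ (r * e θ) = 0 := by
        intro r hr hr0
        refine image_eq_zero_of_notMem_tsupport fun h => ?_
        have := hR h
        rw [mem_ball_zero_iff, hne r θ hr0] at this
        linarith
      have := integral_Ioi_of_hasDerivAt_of_tendsto' (a := 0) (m := 0)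
        (f := fun r : ℝ => φ (r * e θ)) (fun r _ => hd r) ?_ ?_
      · simpa using this
      · have h1 : IntegrableOn (fun r : ℝ => fderiv ℝ φ (r * e θ) (e θ)) (Icc 0 R) := by
          refine Continuous.continuousOn ?_ |>.integrableOn_compact isCompact_Icc
          exact (hD.comp (by fun_prop)).clm_apply continuous_const
        refine h1.of_forall_sdiff_eq_zero measurableSet_Ioi ?_
        rintro r ⟨hr, hn⟩
        have hr' : R ≤ r := by
          by_contra! h
          exact hn ⟨le_of_lt hr, h.le⟩
        have := hD0 (r * e θ) (by rw [hne r θ hr]; exact hr')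
        simp [this]
      · refine tendsto_const_nhds.congr' ?_
        filter_upwards [eventually_ge_atTop R, eventually_gt_atTop 0] with r h1 h2
        exact (hz r h1 h2).symm
    simp only [Function.comp_def, Prod.fst_swap, Prod.snd_swap]
    simp_rw [this]
    simp [Measure.real, Real.pi_pos.le, two_mul]
    ring
  have hv : ∫ p in T, fderiv ℝ φ (p.1 * e p.2) (Complex.I * e p.2) = 0 := by
    have hi := hint _ hie
    rw [hT, Measure.volume_eq_prod] at hi ⊢
    rw [setIntegral_prod _ hi]
    refine setIntegral_eq_zero_of_forall_eq_zero fun r hr => ?_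
    have hr0 : (r : ℂ) ≠ 0 := by exact_mod_cast (ne_of_gt hr)
    have hd : ∀ θ : ℝ, HasDerivAt (fun θ : ℝ => (r : ℂ)⁻¹ * φ (r * e θ))
        (fderiv ℝ φ (r * e θ) (Complex.I * e θ)) θ := by
      intro θ
      have h2 : HasDerivAt (fun θ : ℝ => (r : ℂ) * e θ) (r * (Complex.I * e θ)) θ := by
        refine HasDerivAt.const_mul _ ?_
        have h3 := ((Real.hasDerivAt_cos θ).ofReal_comp).add
          (((Real.hasDerivAt_sin θ).ofReal_comp).mul_const Complex.I)
        refine h3.congr_deriv ?_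
        simp only [he]
        push_cast
        linear_combination (-Complex.sin θ) * Complex.I_mul_I
      have h4 := ((hφ.differentiable one_ne_zero _).hasFDerivAt.comp_hasDerivAt θ h2).const_mul
        (r : ℂ)⁻¹
      refine h4.congr_deriv ?_
      rw [← Complex.real_smul (z := Complex.I * e θ), (fderiv ℝ φ (r * e θ)).map_smul,
        Complex.real_smul, inv_mul_cancel_left₀ hr0]
    rw [← integral_Ioc_eq_integral_Ioo,
      ← intervalIntegral.integral_of_le (by linarith [Real.pi_pos])]
    simp only
    rw [intervalIntegral.integral_eq_sub_of_hasDerivAt (fun θ _ => hd θ)]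
    · simp [he]
    · refine Continuous.intervalIntegrable ?_ _ _
      exact (hD.comp (by fun_prop)).clm_apply (by fun_prop)
  rw [hu, hv]
  ring

/-- The Cauchy–Pompeiu formula for functions of compact support. -/
theorem cauchyTransform_dbar {φ : ℂ → ℂ} (hφ : ContDiff ℝ 1 φ) (hs : HasCompactSupport φ)
    (z : ℂ) : cauchyTransform (dbar φ) z = φ z := by
  have h := integral_dbar_div (φ := fun ζ => φ (ζ + z)) (hφ.comp (by fun_prop))
    (hs.comp_homeomorph (Homeomorph.addRight z))
  have h1 : ∫ ζ, dbar φ ζ / (z - ζ) = - ∫ ζ, dbar (fun ζ => φ (ζ + z)) ζ / ζ := by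
    rw [← integral_add_right_eq_self _ z, ← integral_neg]
    refine integral_congr_ae (Eventually.of_forall fun ζ => ?_)
    simp only [dbar, fderiv_comp_add_right]
    rw [show z - (ζ + z) = -ζ by ring, div_neg]
  rw [cauchyTransform, h1, h]
  have : (Real.pi : ℂ) ≠ 0 := by exact_mod_cast Real.pi_ne_zero
  simp [this]

end CauchyTransform

/-! ### Additive splitting with sup-norm bounds, and the contraction principle. -/

section Splitting

open MeasureTheory
open scoped ContDiff

theorem continuous_dbar {φ : ℂ → ℂ} (hφ : ContDiff ℝ 1 φ) : Continuous (dbar φ) := by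
  have hD : Continuous (fderiv ℝ φ) := hφ.continuous_fderiv one_ne_zero
  unfold dbar
  fun_prop

theorem dbar_mul {χ c : ℂ → ℂ} {z : ℂ} (hχ : DifferentiableAt ℝ χ z)
    (hc : DifferentiableAt ℂ c z) : dbar (fun w => χ w * c w) z = dbar χ z * c z := by
  have h1 : fderiv ℝ c z = (fderiv ℂ c z).restrictScalars ℝ :=
    hc.fderiv_restrictScalars ℝ
  have h2 : fderiv ℂ c z Complex.I = Complex.I * fderiv ℂ c z 1 := by
    simpa only [smul_eq_mul, mul_one] using (fderiv ℂ c z).map_smul Complex.I 1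
  rw [dbar, dbar, fderiv_fun_mul hχ (hc.restrictScalars ℝ), h1]
  simp only [_root_.add_apply, _root_.smul_apply, smul_eq_mul,
    ContinuousLinearMap.coe_restrictScalars', h2]
  linear_combination (χ z * fderiv ℂ c z 1 / 2) * Complex.I_mul_I

theorem dbar_eq_zero_of_eventually_const {χ : ℂ → ℂ} {z k : ℂ} (h : ∀ᶠ w in 𝓝 z, χ w = k) :
    ∀ᶠ w in 𝓝 z, dbar χ w = 0 := by
  filter_upwards [h.eventually_nhds] with w hw
  have : χ =ᶠ[𝓝 w] fun _ => k := hw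
  simp [dbar, this.fderiv_eq]

/-- Additive splitting of holomorphic functions on `A ∩ B`, with sup-norm bounds: every bounded
holomorphic function on `A ∩ B` is the difference of bounded holomorphic functions on `A` and
on `B`. -/
theorem exists_splitting {A B : Set ℂ} (hA : IsOpen A) (hB : IsOpen B)
    (hA' : Bornology.IsBounded A) (hB' : Bornology.IsBounded B)
    {χ : ℂ → ℝ} (hχ : ContDiff ℝ ∞ χ) (h01 : ∀ z, χ z ∈ Icc (0 : ℝ) 1)
    (h0 : ∀ z ∈ A \ B, ∀ᶠ w in 𝓝 z, χ w = 0) (h1 : ∀ z ∈ B \ A, ∀ᶠ w in 𝓝 z, χ w = 1) :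
    ∃ C > 0, ∃ Sa Sb : (ℂ → ℂ) → ℂ → ℂ,
      (∀ c M, 0 ≤ M → DifferentiableOn ℂ c (A ∩ B) → (∀ ζ ∈ A ∩ B, ‖c ζ‖ ≤ M) →
        DifferentiableOn ℂ (Sa c) A ∧ DifferentiableOn ℂ (Sb c) B ∧
        (∀ ζ ∈ A ∩ B, Sa c ζ - Sb c ζ = c ζ) ∧ (∀ ζ ∈ A, ‖Sa c ζ‖ ≤ C * M) ∧
        ∀ ζ ∈ B, ‖Sb c ζ‖ ≤ C * M) ∧
      ∀ c c' M, 0 ≤ M → DifferentiableOn ℂ c (A ∩ B) → (∀ ζ ∈ A ∩ B, ‖c ζ‖ ≤ M) →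
        DifferentiableOn ℂ c' (A ∩ B) → (∀ ζ ∈ A ∩ B, ‖c' ζ‖ ≤ M) →
        ∀ ζ ∈ A, Sa c ζ - Sa c' ζ = Sa (fun z => c z - c' z) ζ := by
  classical
  obtain ⟨R, hR⟩ := (hA'.union hB').subset_ball 0
  have hN : IsOpen (A ∩ B) := hA.inter hB
  have hNR : A ∩ B ⊆ ball 0 R := fun z hz => hR (Or.inl hz.1)
  set X : ℂ → ℂ := fun z => (χ z : ℂ) with hX
  have hXs : ContDiff ℝ ∞ X := Complex.ofRealCLM.contDiff.comp hχ
  obtain ⟨D, hD⟩ : ∃ D, ∀ ζ ∈ closedBall (0 : ℂ) R, ‖dbar X ζ‖ ≤ D :=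
    (isCompact_closedBall _ _).exists_bound_of_continuousOn
      (continuous_dbar (hXs.of_le (by simp))).continuousOn
  set D' := max D 0
  -- The extension by zero creates no jump inside `A ∪ B`, because `χ` is constant near every point
  -- of `A \ B` and of `B \ A`. Jumps at other boundary points are harmless, since only boundedness
  -- and measurability of `g c` are used there.
  set g : (ℂ → ℂ) → ℂ → ℂ := fun c => (A ∩ B).indicator fun ζ => dbar X ζ * c ζ with hg
  have gsupp : ∀ c, ∀ ζ ∉ ball (0 : ℂ) R, g c ζ = 0 := fun c ζ hζ =>
    indicator_of_notMem (fun h => hζ (hNR h)) _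
  have gbound : ∀ c M, 0 ≤ M → (∀ ζ ∈ A ∩ B, ‖c ζ‖ ≤ M) → ∀ ζ, ‖g c ζ‖ ≤ D' * M := by
    intro c M hM hc ζ
    by_cases h : ζ ∈ A ∩ B
    · rw [hg]
      simp only [indicator_of_mem h, norm_mul]
      exact mul_le_mul ((hD ζ (ball_subset_closedBall (hNR h))).trans (le_max_left _ _)) (hc ζ h)
        (norm_nonneg _) (le_max_right _ _)
    · simp only [hg, indicator_of_notMem h, norm_zero]
      exact mul_nonneg (le_max_right _ _) hM
  have gmeas : ∀ c, DifferentiableOn ℂ c (A ∩ B) → AEStronglyMeasurable (g c) := by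
    intro c hc
    rw [hg]
    simp only
    rw [aestronglyMeasurable_indicator_iff hN.measurableSet]
    exact ((continuous_dbar (hXs.of_le (by simp))).continuousOn.mul
      hc.continuousOn).aestronglyMeasurable hN.measurableSet
  have gint : ∀ c M, 0 ≤ M → DifferentiableOn ℂ c (A ∩ B) → (∀ ζ ∈ A ∩ B, ‖c ζ‖ ≤ M) →
      Integrable (g c) := by
    intro c M hM hc hb
    have : IntegrableOn (g c) (ball 0 R) :=
      Measure.integrableOn_of_bounded (M := D' * M) measure_ball_lt_top.ne (gmeas c hc)
        (Eventually.of_forall (gbound c M hM hb))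
    rwa [integrableOn_iff_integrable_of_support_subset] at this
    intro ζ hζ
    by_contra h
    exact hζ (gsupp c ζ h)
  set K := Real.pi⁻¹ * ∫ ζ in ball (0 : ℂ) (2 * R), ‖ζ‖⁻¹ with hK
  have hK0 : 0 ≤ K := by positivity
  have hwb : ∀ c M, 0 ≤ M → (∀ ζ ∈ A ∩ B, ‖c ζ‖ ≤ M) → ∀ z ∈ A ∪ B,
      ‖cauchyTransform (g c) z‖ ≤ K * (D' * M) := fun c M hM hc z hz =>
    norm_cauchyTransform_le (gbound c M hM hc) (gsupp c) (hR hz)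
  have hwd : ∀ c M, 0 ≤ M → DifferentiableOn ℂ c (A ∩ B) → (∀ ζ ∈ A ∩ B, ‖c ζ‖ ≤ M) → ∀ z k,
      (∀ᶠ w in 𝓝 z, χ w = k) → DifferentiableAt ℂ (cauchyTransform (g c)) z := by
    intro c M hM hc hb z k hk
    refine differentiableAt_cauchyTransform (gint c M hM hc hb) ?_
    filter_upwards [dbar_eq_zero_of_eventually_const (χ := X) (k := k)
      (hk.mono fun w hw => by simp [hX, hw])] with w hw
    simp [hg, indicator, hw]
  -- Since `X * c` need not have compact support in `A ∩ B`, it is cut off by a bump `ρ` near `z`.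
  -- Cauchy–Pompeiu turns the difference, near `z`, into the Cauchy transform of `dbar φ - g c`,
  -- which vanishes near `z`.
  have hmid : ∀ c M, 0 ≤ M → DifferentiableOn ℂ c (A ∩ B) → (∀ ζ ∈ A ∩ B, ‖c ζ‖ ≤ M) →
      ∀ z ∈ A ∩ B, DifferentiableAt ℂ (fun w => X w * c w - cauchyTransform (g c) w) z := by
    intro c M hM hc hb z hz
    obtain ⟨ε, hε, hεN⟩ := Metric.isOpen_iff.1 hN z hz
    let ρ : ContDiffBump z := ⟨ε / 4, ε / 2, by positivity, by linarith⟩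
    set φ : ℂ → ℂ := fun w => (ρ w : ℂ) * (X w * c w) with hφ
    have hts : tsupport ρ ⊆ A ∩ B := by
      rw [ρ.tsupport_eq]
      exact (closedBall_subset_ball (by simp only [ρ]; linarith)).trans hεN
    have htφ : tsupport φ ⊆ tsupport ρ := by
      refine closure_mono fun w hw => ?_
      simp only [Function.mem_support, hφ] at hw ⊢
      intro h
      simp [h] at hw
    have hφc : ContDiff ℝ 1 φ := by
      rw [contDiff_iff_contDiffAt]
      intro w
      by_cases hw : w ∈ A ∩ B
      · have h2 : ContDiffAt ℂ 1 c w :=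
          (hc.contDiffOn hN).contDiffAt (hN.mem_nhds hw)
        have h3 : ContDiff ℝ 1 (fun w => (ρ w : ℂ)) :=
          Complex.ofRealCLM.contDiff.comp ρ.contDiff
        exact h3.contDiffAt.mul
          ((hXs.of_le (by simp)).contDiffAt.mul (h2.restrict_scalars ℝ))
      · have : φ =ᶠ[𝓝 w] fun _ => 0 :=
          notMem_tsupport_iff_eventuallyEq.1 fun h => hw (hts (htφ h))
        exact contDiffAt_const.congr_of_eventuallyEq this
    have hφs : HasCompactSupport φ :=
      (ρ.hasCompactSupport.isCompact).of_isClosed_subset (isClosed_tsupport φ) htφ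
    have hds : ∀ ζ ∉ tsupport φ, dbar φ ζ = 0 := by
      intro ζ hζ
      have : φ =ᶠ[𝓝 ζ] fun _ => 0 := notMem_tsupport_iff_eventuallyEq.1 hζ
      exact (dbar_eq_zero_of_eventually_const this).self_of_nhds
    have hdcs : HasCompactSupport (dbar φ) := HasCompactSupport.intro hφs.isCompact hds
    obtain ⟨D₂, hD₂⟩ := (continuous_dbar hφc).bounded_above_of_compact_support hdcs
    have hdR : ∀ ζ ∉ ball (0 : ℂ) R, dbar φ ζ = 0 := fun ζ hζ =>
      hds ζ fun h => hζ (hNR (hts (htφ h)))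
    have hρ1 : ∀ᶠ w in 𝓝 z, φ w = X w * c w := by
      filter_upwards [ρ.eventuallyEq_one] with w hw
      simp [hφ, hw]
    have hzero : ∀ᶠ ζ in 𝓝 z, dbar φ ζ - g c ζ = 0 := by
      filter_upwards [hρ1.eventually_nhds, hN.mem_nhds hz] with w hw hwN
      have hw' : φ =ᶠ[𝓝 w] fun w => X w * c w := hw
      have h4 : dbar φ w = dbar (fun w => X w * c w) w := by
        rw [dbar, dbar, hw'.fderiv_eq]
      rw [h4, dbar_mul (hXs.differentiable (by simp) w)
        ((hc w hwN).differentiableAt (hN.mem_nhds hwN)), hg]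
      simp only [indicator_of_mem hwN, sub_self]
    have hdint : Integrable (dbar φ) :=
      (continuous_dbar hφc).integrable_of_hasCompactSupport hdcs
    refine (differentiableAt_cauchyTransform (hdint.sub (gint c M hM hc hb))
      hzero).congr_of_eventuallyEq ?_
    filter_upwards [hρ1, hN.mem_nhds hz] with w hw hwN
    rw [← hw, ← cauchyTransform_dbar hφc hφs]
    exact (cauchyTransform_sub
      (integrable_div_sub (continuous_dbar hφc).aestronglyMeasurable hD₂ hdR (hNR hwN))
      (integrable_div_sub (gmeas c hc) (gbound c M hM hb) (gsupp c) (hNR hwN))).symm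
  -- With `w` the Cauchy transform of `g c`, the summands are `χ c - w` and `(χ - 1) c - w`. In the
  -- bound, `1` accounts for the cutoff factors and `K * D'` for `w`.
  refine ⟨1 + K * D', by positivity, fun c ζ => (A ∩ B).indicator (fun ζ => X ζ * c ζ) ζ -
    cauchyTransform (g c) ζ, fun c ζ => (A ∩ B).indicator (fun ζ => (X ζ - 1) * c ζ) ζ -
    cauchyTransform (g c) ζ, ?_, ?_⟩
  · intro c M hM hc hb
    refine ⟨fun z hz => ?_, fun z hz => ?_, fun ζ hζ => ?_, fun ζ hζ => ?_, fun ζ hζ => ?_⟩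
    · refine DifferentiableAt.differentiableWithinAt ?_
      by_cases h : z ∈ B
      · refine (hmid c M hM hc hb z ⟨hz, h⟩).congr_of_eventuallyEq ?_
        filter_upwards [hN.mem_nhds ⟨hz, h⟩] with w hw
        simp only [indicator_of_mem hw]
      · refine ((hwd c M hM hc hb z 0 (h0 z ⟨hz, h⟩)).neg).congr_of_eventuallyEq ?_
        filter_upwards [h0 z ⟨hz, h⟩] with w hw
        simp [indicator, hX, hw]
    · refine DifferentiableAt.differentiableWithinAt ?_
      by_cases h : z ∈ A
      · refine ((hmid c M hM hc hb z ⟨h, hz⟩).sub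
          ((hc z ⟨h, hz⟩).differentiableAt (hN.mem_nhds ⟨h, hz⟩))).congr_of_eventuallyEq ?_
        filter_upwards [hN.mem_nhds ⟨h, hz⟩] with w hw
        simp only [indicator_of_mem hw, Pi.sub_apply]
        ring
      · refine ((hwd c M hM hc hb z 1 (h1 z ⟨hz, h⟩)).neg).congr_of_eventuallyEq ?_
        filter_upwards [h1 z ⟨hz, h⟩] with w hw
        simp [indicator, hX, hw]
    · simp only [indicator_of_mem hζ]
      ring
    · have e1 : ‖(A ∩ B).indicator (fun ζ => X ζ * c ζ) ζ‖ ≤ M := by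
        by_cases h : ζ ∈ A ∩ B
        · rw [indicator_of_mem h, norm_mul]
          have : ‖X ζ‖ ≤ 1 := by
            rw [hX]
            simp only [Complex.norm_real, Real.norm_of_nonneg (h01 ζ).1, (h01 ζ).2]
          nlinarith [hb ζ h, norm_nonneg (c ζ)]
        · simpa [indicator_of_notMem h] using hM
      refine (norm_sub_le _ _).trans ?_
      linarith [hwb c M hM hb ζ (Or.inl hζ)]
    · have e1 : ‖(A ∩ B).indicator (fun ζ => (X ζ - 1) * c ζ) ζ‖ ≤ M := by
        by_cases h : ζ ∈ A ∩ B
        · rw [indicator_of_mem h, norm_mul]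
          have : ‖X ζ - 1‖ ≤ 1 := by
            rw [hX]
            simp only
            rw [← Complex.ofReal_one, ← Complex.ofReal_sub, Complex.norm_real,
              Real.norm_eq_abs, abs_le]
            constructor <;> linarith [(h01 ζ).1, (h01 ζ).2]
          nlinarith [hb ζ h, norm_nonneg (c ζ)]
        · simpa [indicator_of_notMem h] using hM
      refine (norm_sub_le _ _).trans ?_
      linarith [hwb c M hM hb ζ (Or.inr hζ)]
  · intro c c' M hM hc hb hc' hb' ζ hζ
    have e1 : g (fun z => c z - c' z) = fun ζ => g c ζ - g c' ζ := by
      funext z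
      by_cases h : z ∈ A ∩ B <;> simp [hg, h, mul_sub]
    have e2 := cauchyTransform_sub
      (integrable_div_sub (gmeas c hc) (gbound c M hM hb) (gsupp c) (hR (Or.inl hζ)))
      (integrable_div_sub (gmeas c' hc') (gbound c' M hM hb') (gsupp c') (hR (Or.inl hζ)))
    simp only [e1, e2]
    by_cases h : ζ ∈ A ∩ B
    · simp only [indicator_of_mem h]; ring
    · simp only [indicator_of_notMem h]; ring

/-- A contraction principle for the sup norm on holomorphic functions. -/
theorem exists_holomorphic_fixedPoint {A : Set ℂ} (hA : IsOpen A) {η ε : ℝ} (hε : 0 ≤ ε)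
    (hεη : 2 * ε ≤ η) (T : (ℂ → ℂ) → ℂ → ℂ)
    (hT : ∀ a, DifferentiableOn ℂ a A → (∀ ζ ∈ A, ‖a ζ‖ ≤ η) → DifferentiableOn ℂ (T a) A)
    (hT0 : ∀ ζ ∈ A, ‖T (fun _ => 0) ζ‖ ≤ ε)
    (hTc : ∀ a a', DifferentiableOn ℂ a A → (∀ ζ ∈ A, ‖a ζ‖ ≤ η) → DifferentiableOn ℂ a' A →
      (∀ ζ ∈ A, ‖a' ζ‖ ≤ η) → ∀ M, (∀ ζ ∈ A, ‖a ζ - a' ζ‖ ≤ M) →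
      ∀ ζ ∈ A, ‖T a ζ - T a' ζ‖ ≤ M / 2) :
    ∃ a, DifferentiableOn ℂ a A ∧ (∀ ζ ∈ A, ‖a ζ‖ ≤ 2 * ε) ∧ ∀ ζ ∈ A, T a ζ = a ζ := by
  have hz : DifferentiableOn ℂ (fun _ : ℂ => (0 : ℂ)) A := differentiableOn_const _
  have hz' : ∀ ζ ∈ A, ‖(fun _ : ℂ => (0 : ℂ)) ζ‖ ≤ 2 * ε := fun ζ _ => by simpa using hε
  -- Picard iteration from `0`. The bound `2 * ε` reproduces itself: `T 0` contributes `ε`, and the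
  -- contraction by `1 / 2` contributes at most `2 * ε / 2`.
  set s : ℕ → ℂ → ℂ := fun n => T^[n] (fun _ => 0) with hs
  have hs1 : ∀ n, s (n + 1) = T (s n) := fun n => Function.iterate_succ_apply' T n _
  have hstay : ∀ n, DifferentiableOn ℂ (s n) A ∧ ∀ ζ ∈ A, ‖s n ζ‖ ≤ 2 * ε := by
    intro n
    induction n with
    | zero => exact ⟨hz, hz'⟩
    | succ n ih =>
      rw [hs1]
      have hn : ∀ ζ ∈ A, ‖s n ζ‖ ≤ η := fun ζ hζ => (ih.2 ζ hζ).trans hεη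
      refine ⟨hT _ ih.1 hn, fun ζ hζ => ?_⟩
      have h1 := hTc (s n) _ ih.1 hn hz (fun ζ hζ => (hz' ζ hζ).trans hεη) (2 * ε)
        (fun ζ hζ => by simpa using ih.2 ζ hζ) ζ hζ
      have h2 := norm_add_le (T (s n) ζ - T (fun _ => 0) ζ) (T (fun _ => 0) ζ)
      rw [sub_add_cancel] at h2
      linarith [hT0 ζ hζ]
  have hstep : ∀ n, ∀ ζ ∈ A, ‖s n ζ - s (n + 1) ζ‖ ≤ 2 * ε / 2 / 2 ^ n := by
    intro n
    induction n with
    | zero =>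
      intro ζ hζ
      have h3 : s (0 + 1) ζ = T (fun _ => 0) ζ := congrFun (hs1 0) ζ
      have h4 : s 0 ζ = 0 := rfl
      rw [h3, h4, zero_sub, norm_neg]
      simpa using hT0 ζ hζ
    | succ n ih =>
      intro ζ hζ
      rw [hs1 n, hs1 (n + 1)]
      refine (hTc _ _ (hstay n).1 (fun ζ hζ => ((hstay n).2 ζ hζ).trans hεη) (hstay (n + 1)).1
        (fun ζ hζ => ((hstay (n + 1)).2 ζ hζ).trans hεη) _ ih ζ hζ).trans (le_of_eq ?_)
      rw [pow_succ]
      ring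
  have hcau : ∀ ζ ∈ A, CauchySeq fun n => s n ζ := fun ζ hζ =>
    cauchySeq_of_le_geometric_two (C := 2 * ε) fun n => by
      rw [dist_eq_norm]; exact hstep n ζ hζ
  have hlim : ∀ ζ : ℂ, ∃ l, ζ ∈ A → Tendsto (fun n => s n ζ) atTop (𝓝 l) := by
    intro ζ
    by_cases hζ : ζ ∈ A
    · obtain ⟨l, hl⟩ := cauchySeq_tendsto_of_complete (hcau ζ hζ)
      exact ⟨l, fun _ => hl⟩
    · exact ⟨0, fun h => absurd h hζ⟩
  choose a ha using hlim
  have hdist : ∀ n, ∀ ζ ∈ A, ‖s n ζ - a ζ‖ ≤ 2 * ε / 2 ^ n := fun n ζ hζ => by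
    rw [← dist_eq_norm]
    exact dist_le_of_le_geometric_two_of_tendsto (C := 2 * ε)
      (fun n => by rw [dist_eq_norm]; exact hstep n ζ hζ) (ha ζ hζ) n
  have hto : Tendsto (fun n : ℕ => 2 * ε / 2 ^ n) atTop (𝓝 0) :=
    tendsto_const_nhds.div_atTop (tendsto_pow_atTop_atTop_of_one_lt one_lt_two)
  have hunif : TendstoUniformlyOn s a atTop A := by
    rw [Metric.tendstoUniformlyOn_iff]
    intro δ hδ
    filter_upwards [hto.eventually (gt_mem_nhds hδ)] with n hn ζ hζ
    rw [dist_comm, dist_eq_norm]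
    exact (hdist n ζ hζ).trans_lt hn
  have had : DifferentiableOn ℂ a A :=
    hunif.tendstoLocallyUniformlyOn.differentiableOn
      (Eventually.of_forall fun n => (hstay n).1) hA
  have hab : ∀ ζ ∈ A, ‖a ζ‖ ≤ 2 * ε := fun ζ hζ =>
    le_of_tendsto (ha ζ hζ).norm (Eventually.of_forall fun n => (hstay n).2 ζ hζ)
  refine ⟨a, had, hab, fun ζ hζ => ?_⟩
  have h5 : Tendsto (fun n => s (n + 1) ζ) atTop (𝓝 (T a ζ)) := by
    rw [tendsto_iff_norm_sub_tendsto_zero]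
    refine squeeze_zero (fun _ => norm_nonneg _) (fun n => ?_) (by simpa using hto.div_const 2)
    rw [hs1]
    exact hTc _ _ (hstay n).1 (fun ζ hζ => ((hstay n).2 ζ hζ).trans hεη) had
      (fun ζ hζ => (hab ζ hζ).trans hεη) _ (hdist n) ζ hζ
  exact tendsto_nhds_unique h5 ((tendsto_add_atTop_iff_nat 1).2 (ha ζ hζ))

end Splitting

/-! ### The nonlinear gluing problem in the plane. -/

section NonlinearSplitting

open scoped ContDiff Manifold

/-- Thickenings of two compact sets, suitable for splitting problems, whose intersection is a
prescribed thickening of the intersection. -/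
theorem exists_splitting_cover {K₁ K₂ : Set ℂ} (h₁ : IsCompact K₁) (h₂ : IsCompact K₂)
    {δ : ℝ} (hδ : 0 < δ) :
    ∃ A B : Set ℂ, IsOpen A ∧ IsOpen B ∧ K₁ ⊆ A ∧ K₂ ⊆ B ∧ A ⊆ thickening δ K₁ ∧
      B ⊆ thickening δ K₂ ∧ A ∩ B = thickening δ (K₁ ∩ K₂) ∧
      ∃ χ : ℂ → ℝ, ContDiff ℝ ∞ χ ∧ (∀ z, χ z ∈ Icc (0 : ℝ) 1) ∧
        (∀ z ∈ A \ B, ∀ᶠ w in 𝓝 z, χ w = 0) ∧ ∀ z ∈ B \ A, ∀ᶠ w in 𝓝 z, χ w = 1 := by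
  set N := thickening δ (K₁ ∩ K₂) with hN
  have hNo : IsOpen N := isOpen_thickening
  have hN1 : N ⊆ thickening δ K₁ := thickening_subset_of_subset _ inter_subset_left
  have hN2 : N ⊆ thickening δ K₂ := thickening_subset_of_subset _ inter_subset_right
  have hKN : K₁ ∩ K₂ ⊆ N := self_subset_thickening hδ _
  have hd : Disjoint (K₁ \ N) (K₂ \ N) := by
    rw [Set.disjoint_left]
    exact fun z hz hz' => hz.2 (hKN ⟨hz.1, hz'.1⟩)
  obtain ⟨χ, h0, h1, h01⟩ := exists_contMDiffMap_zero_one_nhds_of_isClosed 𝓘(ℝ, ℂ) (n := (⊤ : ℕ∞))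
    (h₁.diff hNo).isClosed (h₂.diff hNo).isClosed hd
  rw [eventually_nhdsSet_iff_exists] at h0 h1
  obtain ⟨P, hPo, hP, hP0⟩ := h0
  obtain ⟨Q, hQo, hQ, hQ1⟩ := h1
  have hPQ : Disjoint P Q := by
    rw [Set.disjoint_left]
    intro z hz hz'
    have := hP0 z hz
    rw [hQ1 z hz'] at this
    exact one_ne_zero this
  -- As `P` and `Q` are disjoint, adding `N` to both sides makes the intersection exactly `N`.
  refine ⟨P ∩ thickening δ K₁ ∪ N, Q ∩ thickening δ K₂ ∪ N,
    (hPo.inter isOpen_thickening).union hNo, (hQo.inter isOpen_thickening).union hNo, ?_, ?_,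
    union_subset inter_subset_right hN1, union_subset inter_subset_right hN2, ?_,
    χ, χ.contMDiff.contDiff, h01, ?_, ?_⟩
  · intro z hz
    by_cases h : z ∈ N
    · exact Or.inr h
    · exact Or.inl ⟨hP ⟨hz, h⟩, self_subset_thickening hδ _ hz⟩
  · intro z hz
    by_cases h : z ∈ N
    · exact Or.inr h
    · exact Or.inl ⟨hQ ⟨hz, h⟩, self_subset_thickening hδ _ hz⟩
  · rw [← Set.inter_union_distrib_right, Set.union_eq_right]
    exact fun z hz => absurd hz.2.1 (Set.disjoint_left.1 hPQ hz.1.1)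
  · rintro z ⟨hz | hz, hzB⟩
    · filter_upwards [hPo.mem_nhds hz.1] with w hw using hP0 w hw
    · exact absurd (Or.inr hz) hzB
  · rintro z ⟨hz | hz, hzA⟩
    · filter_upwards [hQo.mem_nhds hz.1] with w hw using hQ1 w hw
    · exact absurd (Or.inr hz) hzA

/-- Each point of the thickening lies in a ball about a point of `K`, and the union of `K` with that
ball is preconnected. -/
theorem isPreconnected_thickening {K : Set ℂ} (hK : IsPreconnected K) {δ : ℝ} (hδ : 0 < δ) :
    IsPreconnected (thickening δ K) := by
  rcases K.eq_empty_or_nonempty with rfl | ⟨p, hp⟩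
  · simpa using isPreconnected_empty
  have hsub := self_subset_thickening hδ K
  refine isPreconnected_of_forall p fun z hz => ?_
  obtain ⟨k, hk, hzk⟩ := mem_thickening_iff.1 hz
  refine ⟨K ∪ ball k δ, union_subset hsub (ball_subset_thickening hk δ), Or.inl hp, Or.inr hzk, ?_⟩
  exact hK.union k hk (mem_ball_self hδ) (convex_ball k δ).isPreconnected

/-- Solution of the gluing problem `F + F' b = Φ (id + a)` on `A ∩ B`, with `a` and `b` small and
holomorphic on `A` and `B`, for `Φ` close to `F`. The constant `C` depends on `A` and `B` only. -/
theorem exists_nonlinear_splitting {A B : Set ℂ} (hA : IsOpen A) (hB : IsOpen B)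
    (hA' : Bornology.IsBounded A) (hB' : Bornology.IsBounded B)
    {χ : ℂ → ℝ} (hχ : ContDiff ℝ ∞ χ) (h01 : ∀ z, χ z ∈ Icc (0 : ℝ) 1)
    (h0 : ∀ z ∈ A \ B, ∀ᶠ w in 𝓝 z, χ w = 0) (h1 : ∀ z ∈ B \ A, ∀ᶠ w in 𝓝 z, χ w = 1) :
    ∃ C > 0, ∃ κ > 0, ∀ (F Φ : ℂ → ℂ) (η ε : ℝ), 0 ≤ ε → C * ε ≤ η →
      (∀ ζ ∈ A ∩ B, DifferentiableAt ℂ F ζ ∧ DifferentiableAt ℂ (deriv F) ζ ∧ deriv F ζ ≠ 0 ∧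
        ‖(Φ ζ - F ζ) / deriv F ζ‖ ≤ ε ∧
        ∀ w ∈ closedBall ζ η, DifferentiableAt ℂ Φ w ∧ ‖1 - deriv Φ w / deriv F ζ‖ ≤ κ) →
      ∃ a b : ℂ → ℂ, DifferentiableOn ℂ a A ∧ DifferentiableOn ℂ b B ∧
        (∀ ζ ∈ A, ‖a ζ‖ ≤ C * ε) ∧ (∀ ζ ∈ B, ‖b ζ‖ ≤ C * ε) ∧
        ∀ ζ ∈ A ∩ B, F ζ + deriv F ζ * b ζ = Φ (ζ + a ζ) := by
  obtain ⟨C, hC, Sa, Sb, hS, hlin⟩ := exists_splitting hA hB hA' hB' hχ h01 h0 h1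
  refine ⟨2 * C, by positivity, (2 * C)⁻¹, by positivity, fun F Φ η ε hε hεη hF => ?_⟩
  have hη : 0 ≤ η := le_trans (by positivity) hεη
  have hN : IsOpen (A ∩ B) := hA.inter hB
  -- The equation forces `b = (Φ (id + a) - F) / F'`, so it reads `a - b = G a`. It is solved by a
  -- fixed point `a = Sa (G a)` with `b = Sb (G a)`. As `Φ'` is close to `F'`, the map `G` has
  -- Lipschitz constant `(2 * C)⁻¹`, and `Sa ∘ G` contracts by `1 / 2`.
  set G : (ℂ → ℂ) → ℂ → ℂ := fun a ζ => a ζ - (Φ (ζ + a ζ) - F ζ) / deriv F ζ with hG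
  have hmem : ∀ (a : ℂ → ℂ) ζ, ‖a ζ‖ ≤ η → ζ + a ζ ∈ closedBall ζ η := fun a ζ h => by
    simpa [mem_closedBall, dist_eq_norm] using h
  have hGd : ∀ a, DifferentiableOn ℂ a A → (∀ ζ ∈ A, ‖a ζ‖ ≤ η) →
      DifferentiableOn ℂ (G a) (A ∩ B) := by
    intro a ha hb ζ hζ
    obtain ⟨d1, d2, d3, -, d4⟩ := hF ζ hζ
    have da := (ha ζ hζ.1).differentiableAt (hA.mem_nhds hζ.1)
    refine DifferentiableAt.differentiableWithinAt ?_
    have d5 : DifferentiableAt ℂ (fun z => Φ (z + a z)) ζ :=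
      DifferentiableAt.comp (f := fun z => z + a z) ζ (d4 _ (hmem a ζ (hb ζ hζ.1))).1
        (differentiableAt_id.add da)
    exact da.sub ((d5.sub d1).div d2 d3)
  have hGl : ∀ a a' : ℂ → ℂ, (∀ ζ ∈ A, ‖a ζ‖ ≤ η) → (∀ ζ ∈ A, ‖a' ζ‖ ≤ η) → ∀ ζ ∈ A ∩ B,
      ‖G a ζ - G a' ζ‖ ≤ (2 * C)⁻¹ * ‖a ζ - a' ζ‖ := by
    intro a a' ha ha' ζ hζ
    obtain ⟨-, -, d3, -, d4⟩ := hF ζ hζ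
    have key := (convex_closedBall ζ η).norm_image_sub_le_of_norm_hasDerivWithin_le
      (f := fun w => w - Φ w / deriv F ζ) (f' := fun w => 1 - deriv Φ w / deriv F ζ)
      (fun w hw => (((hasDerivAt_id w).sub
        ((d4 w hw).1.hasDerivAt.div_const _)).hasDerivWithinAt)) (fun w hw => (d4 w hw).2)
      (hmem a' ζ (ha' ζ hζ.1)) (hmem a ζ (ha ζ hζ.1))
    refine le_trans (le_of_eq ?_) (key.trans (le_of_eq ?_))
    · congr 1
      simp only [hG]
      ring
    · congr 2
      ring
  have hG0 : ∀ ζ ∈ A ∩ B, ‖G (fun _ => 0) ζ‖ ≤ ε := by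
    intro ζ hζ
    simpa [hG] using (hF ζ hζ).2.2.2.1
  have hGb : ∀ a : ℂ → ℂ, ∀ M, (∀ ζ ∈ A, ‖a ζ‖ ≤ M) → M ≤ η → ∀ ζ ∈ A ∩ B,
      ‖G a ζ‖ ≤ ε + (2 * C)⁻¹ * M := by
    intro a M ha hM ζ hζ
    have e1 := hGl a (fun _ => 0) (fun ζ hζ => (ha ζ hζ).trans hM) (fun _ _ => by simpa using hη)
      ζ hζ
    have e2 := norm_add_le (G a ζ - G (fun _ => 0) ζ) (G (fun _ => 0) ζ)
    rw [sub_add_cancel] at e2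
    rw [sub_zero] at e1
    have e3 : (2 * C)⁻¹ * ‖a ζ‖ ≤ (2 * C)⁻¹ * M :=
      mul_le_mul_of_nonneg_left (ha ζ hζ.1) (by positivity)
    linarith [hG0 ζ hζ]
  have hz : DifferentiableOn ℂ (fun _ : ℂ => (0 : ℂ)) A := differentiableOn_const _
  have hη' : ∀ a : ℂ → ℂ, (∀ ζ ∈ A, ‖a ζ‖ ≤ η) → ∀ ζ ∈ A ∩ B,
      ‖G a ζ‖ ≤ ε + (2 * C)⁻¹ * η := fun a ha => hGb a η ha le_rfl
  obtain ⟨a, had, hab, hfix⟩ := exists_holomorphic_fixedPoint hA (η := η) (ε := C * ε)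
    (by positivity) (by linarith) (fun a => Sa (G a))
    (fun a ha hb => (hS (G a) _ (by positivity) (hGd a ha hb) (hη' a hb)).1)
    (fun ζ hζ => (hS _ ε hε (hGd _ hz fun _ _ => by simpa using hη) hG0).2.2.2.1 ζ hζ)
    (fun a a' ha hb ha' hb' M hM ζ hζ => by
      have hM0 : 0 ≤ M := (norm_nonneg _).trans (hM ζ hζ)
      rw [hlin _ _ (ε + (2 * C)⁻¹ * η) (by positivity) (hGd a ha hb) (hη' a hb)
        (hGd a' ha' hb') (hη' a' hb') ζ hζ]
      refine ((hS _ ((2 * C)⁻¹ * M) (by positivity)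
        ((hGd a ha hb).sub (hGd a' ha' hb')) ?_).2.2.2.1 ζ hζ).trans (le_of_eq ?_)
      · exact fun z hz => (hGl a a' hb hb' z hz).trans
          (mul_le_mul_of_nonneg_left (hM z hz.1) (by positivity))
      · field_simp)
  have hab' : ∀ ζ ∈ A, ‖a ζ‖ ≤ 2 * C * ε := fun ζ hζ => (hab ζ hζ).trans (by linarith)
  -- The bound on `G a` is `ε + (2 * C)⁻¹ * (2 * C * ε) = 2 * ε`.
  have hfin := hS (G a) (2 * ε) (by positivity)
    (hGd a had fun ζ hζ => (hab' ζ hζ).trans hεη) (fun ζ hζ => by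
      refine (hGb a _ hab' hεη ζ hζ).trans (le_of_eq ?_)
      field_simp
      ring)
  refine ⟨a, Sb (G a), had, hfin.2.1, hab', fun ζ hζ => (hfin.2.2.2.2 ζ hζ).trans (by linarith),
    fun ζ hζ => ?_⟩
  have e1 := hfin.2.2.1 ζ hζ
  rw [hfix ζ hζ.1] at e1
  have d3 := (hF ζ hζ).2.2.1
  have e2 : Sb (G a) ζ = (Φ (ζ + a ζ) - F ζ) / deriv F ζ := by
    simp only [hG] at e1 ⊢
    linear_combination -e1
  rw [e2]
  field_simp
  ring

end NonlinearSplitting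

/-- A locally constant function is continuous for the discrete topology on its codomain. It is
applied to transverse coordinates, and to propositions as truth values. -/
theorem IsPreconnected.eq_of_eventually_eq {α β : Type*} [TopologicalSpace α] {s : Set α}
    (hs : IsPreconnected s) {f : α → β} (hf : ∀ x ∈ s, ∀ᶠ y in 𝓝 x, f y = f x) {x y : α}
    (hx : x ∈ s) (hy : y ∈ s) : f x = f y := by
  let _ : TopologicalSpace β := ⊥
  have : DiscreteTopology β := ⟨rfl⟩
  refine hs.constant (f := f) (fun z hz => ?_) hx hy
  have hc : ContinuousAt f z := continuousAt_const.congr (f := fun _ => f z) (by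
    filter_upwards [hf z hz] with w hw using hw.symm)
  exact hc.continuousWithinAt

/-! ### Holomorphic maps to leaves and their critical points. -/

namespace RiemannSurfaceLamination

variable {X : Type u} [TopologicalSpace X] (L : RiemannSurfaceLamination.{u, v, w} X)

/-- `h` is, near `ζ`, a holomorphic map to a leaf. -/
def HolAt (h : ℂ → X) (ζ : ℂ) : Prop :=
  ∀ a, h ζ ∈ (L.box a).source → (∀ᶠ w in 𝓝 ζ, h w ∈ L.plaque a (L.box a (h ζ)).2) ∧
    DifferentiableAt ℂ (fun w => (L.box a (h w)).1) ζ

variable {L}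

theorem box_fst_mem_ball {a : L.ι} {x : X} (hx : x ∈ (L.box a).source) :
    (L.box a x).1 ∈ ball (0 : ℂ) 1 := by
  have := (L.box a).map_source hx
  rw [L.box_target] at this
  exact this.1

theorem mem_box_target {a : L.ι} {z : ℂ} (hz : z ∈ ball (0 : ℂ) 1) (t : L.T a) :
    (z, t) ∈ (L.box a).target := by
  rw [L.box_target]
  exact ⟨hz, mem_univ _⟩

theorem box_symm_of_mem_plaque {a : L.ι} {t : L.T a} {x : X} (hx : x ∈ L.plaque a t) :
    (L.box a).symm ((L.box a x).1, t) = x := by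
  rw [← hx.2]
  exact (L.box a).left_inv hx.1

/-- Within a fixed plaque `h` is recovered from its coordinate `z_a` by the inverse chart, so
continuity of that coordinate is enough. -/
theorem continuousAt_of_eventually_mem_plaque {a : L.ι} {h : ℂ → X} {ζ : ℂ}
    (ha : h ζ ∈ (L.box a).source) (hp : ∀ᶠ w in 𝓝 ζ, h w ∈ L.plaque a (L.box a (h ζ)).2)
    (hd : ContinuousAt (fun w => (L.box a (h w)).1) ζ) : ContinuousAt h ζ := by
  have h1 : ContinuousAt (fun w => (L.box a).symm ((L.box a (h w)).1, (L.box a (h ζ)).2)) ζ := by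
    refine ContinuousAt.comp (f := fun w => ((L.box a (h w)).1, (L.box a (h ζ)).2))
      (g := (L.box a).symm) ?_ (hd.prodMk continuousAt_const)
    exact (L.box a).continuousAt_symm ((L.box a).map_source ha)
  refine h1.congr ?_
  filter_upwards [hp] with w hw using box_symm_of_mem_plaque hw

theorem HolAt.continuousAt {h : ℂ → X} {ζ : ℂ} (hh : L.HolAt h ζ) : ContinuousAt h ζ := by
  obtain ⟨a, ha⟩ := L.cover (h ζ)
  exact continuousAt_of_eventually_mem_plaque ha (hh a ha).1 (hh a ha).2.continuousAt

/-- Holomorphy can be tested in one flow box. -/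
theorem holAt_of_box {a : L.ι} {h : ℂ → X} {ζ : ℂ} (ha : h ζ ∈ (L.box a).source)
    (hp : ∀ᶠ w in 𝓝 ζ, h w ∈ L.plaque a (L.box a (h ζ)).2)
    (hd : DifferentiableAt ℂ (fun w => (L.box a (h w)).1) ζ) : L.HolAt h ζ := by
  intro b hb
  have hc := continuousAt_of_eventually_mem_plaque ha hp hd.continuousAt
  -- The transverse part `τ` of the change of flow boxes depends on the plaque only, so it sends the
  -- plaque of `a` locally into one plaque of `b`.
  obtain ⟨τ, hτ⟩ := L.compat a b (L.box a (h ζ)) (by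
    simp [(L.box a).map_source ha, (L.box a).left_inv ha, hb])
  have hca : ContinuousAt (fun w => L.box a (h w)) ζ :=
    ((L.box a).continuousAt ha).comp hc
  have hbs : ∀ᶠ w in 𝓝 ζ, h w ∈ (L.box b).source :=
    hc.eventually_mem ((L.box b).open_source.mem_nhds hb)
  refine ⟨?_, ?_⟩
  · filter_upwards [hbs, hp, hca.eventually hτ] with w hw hpw hτw
    refine ⟨hw, ?_⟩
    have h1 := hτw.1
    rw [(L.box a).left_inv hpw.1, hpw.2] at h1
    have h2 := hτ.self_of_nhds.1
    rw [(L.box a).left_inv ha] at h2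
    rw [h1, h2]
  · have h3 := hτ.self_of_nhds.2
    refine (h3.comp (f := fun w => (L.box a (h w)).1) ζ hd).congr_of_eventuallyEq ?_
    filter_upwards [hp] with w hw
    simp only [Function.comp, box_symm_of_mem_plaque hw]

theorem HolAt.congr {h h' : ℂ → X} {ζ : ℂ} (hh : L.HolAt h ζ) (he : h' =ᶠ[𝓝 ζ] h) :
    L.HolAt h' ζ := by
  intro a ha
  rw [he.self_of_nhds] at ha ⊢
  refine ⟨?_, (hh a ha).2.congr_of_eventuallyEq (he.fun_comp fun x => (L.box a x).1)⟩
  filter_upwards [(hh a ha).1, he] with w hw hew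
  rwa [hew]

theorem HolAt.comp {h : ℂ → X} {α : ℂ → ℂ} {ζ : ℂ} (hh : L.HolAt h (α ζ))
    (hα : DifferentiableAt ℂ α ζ) : L.HolAt (fun z => h (α z)) ζ := by
  intro a ha
  exact ⟨hα.continuousAt.eventually (hh a ha).1,
    DifferentiableAt.comp (g := fun w => (L.box a (h w)).1) ζ (hh a ha).2 hα⟩

theorem holAt_box_symm {a : L.ι} {f : ℂ → ℂ} {ζ : ℂ} (t : L.T a) (hf : DifferentiableAt ℂ f ζ)
    (hζ : f ζ ∈ ball (0 : ℂ) 1) : L.HolAt (fun w => (L.box a).symm (f w, t)) ζ := by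
  have h1 : ∀ᶠ w in 𝓝 ζ, f w ∈ ball (0 : ℂ) 1 :=
    hf.continuousAt.eventually_mem (isOpen_ball.mem_nhds hζ)
  refine holAt_of_box (a := a) ((L.box a).map_target (mem_box_target hζ t)) ?_ ?_
  · filter_upwards [h1] with w hw
    refine ⟨(L.box a).map_target (mem_box_target hw t), ?_⟩
    rw [(L.box a).right_inv (mem_box_target hw t), (L.box a).right_inv (mem_box_target hζ t)]
  · refine hf.congr_of_eventuallyEq ?_
    filter_upwards [h1] with w hw
    rw [(L.box a).right_inv (mem_box_target hw t)]

theorem IsHolomorphicDisc.holAt {x : X} {f : ℂ → X} (hf : L.IsHolomorphicDisc x f) {ζ : ℂ}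
    (hζ : ζ ∈ ball (0 : ℂ) 1) : L.HolAt f ζ := by
  intro a ha
  refine ⟨?_, hf.differentiableAt a ζ hζ ha⟩
  have hc : @ContinuousAt ℂ X _ L.leafTopology f ζ :=
    @ContinuousOn.continuousAt ℂ X _ L.leafTopology f _ ζ hf.continuousOn
      (isOpen_ball.mem_nhds hζ)
  have ho : IsOpen[L.leafTopology] (L.plaque a (L.box a (f ζ)).2) :=
    TopologicalSpace.isOpen_generateFrom_of_mem (Or.inl ⟨a, _, rfl⟩)
  exact hc (@IsOpen.mem_nhds X L.leafTopology _ _ ho ⟨ha, rfl⟩)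

theorem IsSaturated.eventually_mem_iff {S : Set X} (hS : L.IsSaturated S) {h : ℂ → X} {ζ : ℂ}
    (hh : L.HolAt h ζ) : ∀ᶠ w in 𝓝 ζ, (h w ∈ S ↔ h ζ ∈ S) := by
  obtain ⟨a, ha⟩ := L.cover (h ζ)
  filter_upwards [(hh a ha).1] with w hw
  exact ⟨fun h1 => hS _ h1 a hw.1 ⟨ha, hw.2.symm⟩, fun h1 => hS _ h1 a ha hw⟩

/-- Membership in a saturated set is locally constant along `h`, so connectedness of the disc keeps
all values in the leaf through `h 0`. -/
theorem mem_discs_of_holAt {x : X} {h : ℂ → X} (hh : ∀ ζ ∈ ball (0 : ℂ) 1, L.HolAt h ζ)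
    (h0 : h 0 = x) : h ∈ L.discs x := by
  have hz : (0 : ℂ) ∈ ball (0 : ℂ) 1 := mem_ball_self one_pos
  refine ⟨⟨fun ζ hζ => ?_, ?_, fun a ζ hζ ha => (hh ζ hζ a ha).2⟩, h0⟩
  · have := (convex_ball (0 : ℂ) 1).isPreconnected.eq_of_eventually_eq
      (f := fun ζ => h ζ ∈ L.leaf x) (fun ζ hζ => by
        filter_upwards [(L.isSaturated_leaf x).eventually_mem_iff (hh ζ hζ)] with w hw
        exact propext hw) hz hζ
    rw [h0] at this
    exact this.mp (L.mem_leaf x)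
  · intro ζ hζ
    refine @ContinuousAt.continuousWithinAt ℂ X _ L.leafTopology h _ ζ ?_
    unfold ContinuousAt
    rw [TopologicalSpace.tendsto_nhds_generateFrom_iff]
    rintro s (⟨a, t, rfl⟩ | hs) hm
    · filter_upwards [(hh ζ hζ a hm.1).1] with w hw
      exact ⟨hw.1, hw.2.trans hm.2⟩
    · exact (hh ζ hζ).continuousAt.eventually_mem (hs.mem_nhds hm)

theorem snd_box_eq_of_isPreconnected {h : ℂ → X} {U : Set ℂ} (hU : IsPreconnected U)
    (hh : ∀ ζ ∈ U, L.HolAt h ζ) {a : L.ι} (ha : ∀ ζ ∈ U, h ζ ∈ (L.box a).source) {ζ ξ : ℂ}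
    (hζ : ζ ∈ U) (hξ : ξ ∈ U) : (L.box a (h ζ)).2 = (L.box a (h ξ)).2 :=
  hU.eq_of_eventually_eq (f := fun z => (L.box a (h z)).2) (fun z hz => by
    filter_upwards [(hh z hz a (ha z hz)).1] with w hw using hw.2) hζ hξ

variable (L) in
/-- The derivative of `h` vanishes at `ζ`, in some flow box. -/
def IsCritical (h : ℂ → X) (ζ : ℂ) : Prop :=
  ∃ a, h ζ ∈ (L.box a).source ∧ deriv (fun w => (L.box a (h w)).1) ζ = 0

/-- By the chain rule for the change of coordinates along the plaque, being critical does not depend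
on the flow box. -/
theorem deriv_eq_zero_of_isCritical {h : ℂ → X} {ζ : ℂ} (hh : L.HolAt h ζ)
    (hc : L.IsCritical h ζ) {b : L.ι} (hb : h ζ ∈ (L.box b).source) :
    deriv (fun w => (L.box b (h w)).1) ζ = 0 := by
  obtain ⟨a, ha, h0⟩ := hc
  obtain ⟨hP, hd'⟩ := hh a ha
  obtain ⟨τ, hτ⟩ := L.compat a b (L.box a (h ζ)) (by
    simp [(L.box a).map_source ha, (L.box a).left_inv ha, hb])
  have hd := hτ.self_of_nhds.2
  have heq : (fun w => (L.box b (h w)).1) =ᶠ[𝓝 ζ]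
      (fun z : ℂ => (L.box b ((L.box a).symm (z, (L.box a (h ζ)).2))).1) ∘
        (fun w => (L.box a (h w)).1) := by
    filter_upwards [hP] with w hw
    simp only [Function.comp, box_symm_of_mem_plaque hw]
  rw [heq.deriv_eq, deriv_comp ζ hd hd', h0, mul_zero]

/-- By the identity theorem in a flow box, near each point either all points are critical or none
other than the point itself. The first alternative is locally constant along `U` and fails at `p`.
The critical points are therefore isolated, and an isolated subset of the plane is countable. -/
theorem countable_isCritical {h : ℂ → X} {U : Set ℂ} (hUo : IsOpen U) (hU : IsPreconnected U)
    (hh : ∀ ζ ∈ U, L.HolAt h ζ) {p : ℂ} (hp : p ∈ U) (hpc : ¬ L.IsCritical h p) :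
    {ζ ∈ U | L.IsCritical h ζ}.Countable := by
  have halt : ∀ ζ ∈ U, (∀ᶠ w in 𝓝 ζ, L.IsCritical h w) ∨
      ∀ᶠ w in 𝓝[≠] ζ, ¬ L.IsCritical h w := by
    intro ζ hζ
    obtain ⟨a, ha⟩ := L.cover (h ζ)
    have hev : ∀ᶠ w in 𝓝 ζ, w ∈ U ∧ h w ∈ (L.box a).source :=
      (hUo.eventually_mem hζ).and ((hh ζ hζ).continuousAt.eventually_mem
        ((L.box a).open_source.mem_nhds ha))
    have han : AnalyticAt ℂ (fun w => (L.box a (h w)).1) ζ := by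
      rw [Complex.analyticAt_iff_eventually_differentiableAt]
      filter_upwards [hev] with w hw using (hh w hw.1 a hw.2).2
    rcases han.deriv.eventually_eq_zero_or_eventually_ne_zero with h1 | h1
    · left
      filter_upwards [h1, hev] with w hw hw'
      exact ⟨a, hw'.2, hw⟩
    · right
      filter_upwards [h1, hev.filter_mono nhdsWithin_le_nhds] with w hw hw' hcr
      exact hw (deriv_eq_zero_of_isCritical (hh w hw'.1) hcr hw'.2)
  have hnot : ∀ ζ ∈ U, ¬ ∀ᶠ w in 𝓝 ζ, L.IsCritical h w := by
    intro ζ hζ hcr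
    have := hU.eq_of_eventually_eq (f := fun ζ => ∀ᶠ w in 𝓝 ζ, L.IsCritical h w)
      (fun z hz => by
        rcases halt z hz with h1 | h1
        · filter_upwards [h1.eventually_nhds] with w hw
          exact propext ⟨fun _ => h1, fun _ => hw⟩
        · by_cases h2 : ∀ᶠ w in 𝓝 z, L.IsCritical h w
          · filter_upwards [h2.eventually_nhds] with w hw
            exact propext ⟨fun _ => h2, fun _ => hw⟩
          · rw [eventually_nhdsWithin_iff] at h1
            filter_upwards [h1] with w hw
            refine propext ⟨fun h3 => ?_, fun h3 => absurd h3 h2⟩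
            by_cases hwz : w = z
            · rwa [hwz] at h3
            · exact absurd h3.self_of_nhds (hw hwz)) hζ hp
    exact hpc (this.mp hcr).self_of_nhds
  obtain ⟨t, -, htc, ht⟩ := TopologicalSpace.countable_cover_nhdsWithin
    (s := {ζ ∈ U | L.IsCritical h ζ}) (f := fun x => {x}) (fun ζ hζ => by
      have h1 := (halt ζ hζ.1).resolve_left (hnot ζ hζ.1)
      rw [eventually_nhdsWithin_iff] at h1
      rw [mem_nhdsWithin_iff_eventually]
      filter_upwards [h1] with w hw hws
      by_contra hne
      exact hw hne hws.2)
  refine htc.mono fun z hz => ?_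
  obtain ⟨i, hi, hzi⟩ := mem_iUnion₂.1 (ht hz)
  rwa [mem_singleton_iff.1 hzi]

/-! ### Approximation of a map by maps to nearby leaves. -/

variable (L) in
/-- The maps `h y` are holomorphic maps from `U` to leaves, and tend to `f` locally uniformly
on `U` along the filter `l`. -/
structure Approximates {Y : Type*} (l : Filter Y) (f : ℂ → X) (h : Y → ℂ → X) (U : Set ℂ) :
    Prop where
  holAt : ∀ᶠ y in l, ∀ ζ ∈ U, L.HolAt (h y) ζ
  tendsto : ∀ ζ ∈ U, Tendsto (fun p : Y × ℂ => h p.1 p.2) (l ×ˢ 𝓝 ζ) (𝓝 (f ζ))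

/-- The tube lemma for a filter. It replaces uniform convergence on compact sets, which has no
meaning in `X` without a uniform structure. -/
theorem _root_.IsCompact.eventually_forall_of_prod {Y : Type*} {l : Filter Y} {K : Set ℂ}
    (hK : IsCompact K) {P : Y → ℂ → Prop} (hP : ∀ ζ ∈ K, ∀ᶠ p in l ×ˢ 𝓝 ζ, P p.1 p.2) :
    ∀ᶠ y in l, ∀ ζ ∈ K, P y ζ := by
  have := hK.mem_prod_nhdsSet_of_forall (s := {p : Y × ℂ | P p.1 p.2}) hP
  obtain ⟨s, hs, t, ht, hst⟩ := mem_prod_iff.1 this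
  filter_upwards [hs] with y hy ζ hζ
  exact hst (Set.mk_mem_prod hy (subset_of_mem_nhdsSet ht hζ))

namespace Approximates

variable {Y : Type*} {l : Filter Y} {f : ℂ → X} {h : Y → ℂ → X} {U : Set ℂ}

theorem mono (H : L.Approximates l f h U) {V : Set ℂ} (hV : V ⊆ U) : L.Approximates l f h V :=
  ⟨H.holAt.mono fun _ hy ζ hζ => hy ζ (hV hζ), fun ζ hζ => H.tendsto ζ (hV hζ)⟩

theorem eventually_mapsTo (H : L.Approximates l f h U) {K : Set ℂ} (hK : IsCompact K)
    (hKU : K ⊆ U) {O : Set X} (hO : IsOpen O) (hfO : MapsTo f K O) :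
    ∀ᶠ y in l, MapsTo (h y) K O :=
  hK.eventually_forall_of_prod fun ζ hζ =>
    (H.tendsto ζ (hKU hζ)).eventually_mem (hO.mem_nhds (hfO hζ))

theorem tendsto_box (H : L.Approximates l f h U) {a : L.ι} {ζ : ℂ} (hζ : ζ ∈ U)
    (ha : f ζ ∈ (L.box a).source) :
    Tendsto (fun p : Y × ℂ => L.box a (h p.1 p.2)) (l ×ˢ 𝓝 ζ) (𝓝 (L.box a (f ζ))) :=
  ((L.box a).continuousAt ha).tendsto.comp (H.tendsto ζ hζ)

theorem tendstoLocallyUniformlyOn (H : L.Approximates l f h U) (hf : ∀ ζ ∈ U, L.HolAt f ζ)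
    {a : L.ι} (ha : ∀ ζ ∈ U, f ζ ∈ (L.box a).source) :
    TendstoLocallyUniformlyOn (fun y ζ => (L.box a (h y ζ)).1) (fun ζ => (L.box a (f ζ)).1) l U := by
  rw [tendstoLocallyUniformlyOn_iff_forall_tendsto]
  intro ζ hζ
  have h1 : Tendsto (fun p : Y × ℂ => (L.box a (h p.1 p.2)).1) (l ×ˢ 𝓝[U] ζ)
      (𝓝 (L.box a (f ζ)).1) :=
    ((continuous_fst.tendsto _).comp (H.tendsto_box hζ (ha ζ hζ))).mono_left
      (prod_mono_right _ nhdsWithin_le_nhds)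
  have h2 : Tendsto (fun p : Y × ℂ => (L.box a (f p.2)).1) (l ×ˢ 𝓝[U] ζ)
      (𝓝 (L.box a (f ζ)).1) :=
    ((hf ζ hζ a (ha ζ hζ)).2.continuousAt.tendsto.mono_left nhdsWithin_le_nhds).comp tendsto_snd
  exact (h2.prodMk_nhds h1).mono_right (nhds_le_uniformity _)

end Approximates

end RiemannSurfaceLamination

/-- The rate is the sup distance itself. The gluing needs such a rate because the corrections are
bounded by a constant multiple of it and must tend to zero. -/
theorem TendstoUniformlyOn.exists_rate {Y α β : Type*} [PseudoMetricSpace β] {l : Filter Y}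
    {G : Y → α → β} {F : α → β} {K : Set α} (h : TendstoUniformlyOn G F l K) :
    ∃ ε : Y → ℝ, (∀ y, 0 ≤ ε y) ∧ Tendsto ε l (𝓝 0) ∧
      ∀ᶠ y in l, ∀ ζ ∈ K, dist (G y ζ) (F ζ) ≤ ε y := by
  have hb : ∀ r > 0, ∀ᶠ y in l, (⨆ ζ ∈ K, edist (G y ζ) (F ζ)) ≤ ENNReal.ofReal r := by
    intro r hr
    filter_upwards [Metric.tendstoUniformlyOn_iff.1 h r hr] with y hy
    refine iSup₂_le fun ζ hζ => ?_
    rw [edist_dist, dist_comm]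
    exact ENNReal.ofReal_le_ofReal (hy ζ hζ).le
  refine ⟨fun y => (⨆ ζ ∈ K, edist (G y ζ) (F ζ)).toReal, fun y => ENNReal.toReal_nonneg, ?_, ?_⟩
  · rw [Metric.tendsto_nhds]
    intro r hr
    filter_upwards [hb (r / 2) (half_pos hr)] with y hy
    rw [Real.dist_eq, sub_zero, abs_of_nonneg ENNReal.toReal_nonneg]
    have := ENNReal.toReal_mono ENNReal.ofReal_ne_top hy
    rw [ENNReal.toReal_ofReal (half_pos hr).le] at this
    linarith
  · filter_upwards [hb 1 one_pos] with y hy ζ hζ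
    rw [dist_edist]
    exact ENNReal.toReal_mono (hy.trans_lt ENNReal.ofReal_lt_top).ne
      (le_iSup₂ (f := fun ζ _ => edist (G y ζ) (F ζ)) ζ hζ)

/-! ### Deformations to nearby leaves and their gluing. -/

namespace RiemannSurfaceLamination

variable {X : Type u} [TopologicalSpace X] (L : RiemannSurfaceLamination.{u, v, w} X)

/-- Near the compact set `K`, the map `f` deforms to holomorphic maps `h y` to leaves, where `h y`
takes `0` to the plaque `τ y`. -/
def Deforms {Y : Type*} (l : Filter Y) (f : ℂ → X) (a₀ : L.ι) (τ : Y → L.T a₀) (K : Set ℂ) :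
    Prop :=
  ∃ U, IsOpen U ∧ K ⊆ U ∧ ∃ h : Y → ℂ → X, L.Approximates l f h U ∧
    ∀ᶠ y in l, h y 0 ∈ L.plaque a₀ (τ y)

variable {L}

theorem Deforms.mono {Y : Type*} {l : Filter Y} {f : ℂ → X} {a₀ : L.ι} {τ : Y → L.T a₀}
    {K K' : Set ℂ} (H : L.Deforms l f a₀ τ K) (hK : K' ⊆ K) : L.Deforms l f a₀ τ K' := by
  obtain ⟨U, hU, hKU, h⟩ := H
  exact ⟨U, hU, hK.trans hKU, h⟩

/-- Within one flow box, keep the coordinate `z_a` of `f` and replace its transverse coordinate by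
`τ y`. -/
theorem deforms_of_mapsTo_plaque {Y : Type*} {l : Filter Y} {f : ℂ → X} {a₀ : L.ι}
    {τ : Y → L.T a₀} {t₀ : L.T a₀} (hτ : Tendsto τ l (𝓝 t₀)) {U : Set ℂ} (hU : IsOpen U)
    (hf : ∀ ζ ∈ U, L.HolAt f ζ) (hfU : MapsTo f U (L.plaque a₀ t₀)) (h0 : (0 : ℂ) ∈ U) :
    L.Deforms l f a₀ τ U := by
  have hm : ∀ ζ ∈ U, (L.box a₀ (f ζ)).1 ∈ ball (0 : ℂ) 1 := fun ζ hζ =>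
    box_fst_mem_ball (hfU hζ).1
  refine ⟨U, hU, Subset.rfl, fun y ζ => (L.box a₀).symm ((L.box a₀ (f ζ)).1, τ y), ⟨?_, ?_⟩, ?_⟩
  · exact Eventually.of_forall fun y ζ hζ =>
      holAt_box_symm (τ y) (hf ζ hζ a₀ (hfU hζ).1).2 (hm ζ hζ)
  · intro ζ hζ
    have h1 := (L.box a₀).continuousAt_symm (mem_box_target (hm ζ hζ) t₀)
    have h2 : Tendsto (fun p : Y × ℂ => ((L.box a₀ (f p.2)).1, τ p.1)) (l ×ˢ 𝓝 ζ)
        (𝓝 ((L.box a₀ (f ζ)).1, t₀)) :=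
      ((hf ζ hζ a₀ (hfU hζ).1).2.continuousAt.tendsto.comp tendsto_snd).prodMk_nhds
        (hτ.comp tendsto_fst)
    have h3 := h1.tendsto.comp h2
    rwa [box_symm_of_mem_plaque (hfU hζ)] at h3
  · refine Eventually.of_forall fun y => ⟨(L.box a₀).map_target (mem_box_target (hm 0 h0) _), ?_⟩
    rw [(L.box a₀).right_inv (mem_box_target (hm 0 h0) _)]

theorem isOpen_setOf_mem_plaque {f : ℂ → X} {Ω : Set ℂ} (hΩ : IsOpen Ω)
    (hf : ∀ ζ ∈ Ω, L.HolAt f ζ) (a : L.ι) (t : L.T a) :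
    IsOpen {ζ ∈ Ω | f ζ ∈ L.plaque a t} := by
  rw [isOpen_iff_mem_nhds]
  rintro ζ ⟨hζ, h1⟩
  filter_upwards [(hf ζ hζ a h1.1).1, hΩ.mem_nhds hζ] with w hw hwΩ
  exact ⟨hwΩ, hw.1, hw.2.trans h1.2⟩

/-- Deformations over a compact set extend over a further compact set in a flow box. -/
theorem Deforms.union {Y : Type*} {l : Filter Y} {f : ℂ → X} {a₀ : L.ι} {τ : Y → L.T a₀}
    {Ω K₁ K₂ : Set ℂ} (hΩ : IsOpen Ω) (hf : ∀ ζ ∈ Ω, L.HolAt f ζ)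
    (h₁ : IsCompact K₁) (h₂ : IsCompact K₂) (hK₁ : K₁ ⊆ Ω) (hK₂ : K₂ ⊆ Ω)
    (h0 : (0 : ℂ) ∈ K₁) (hf0 : f 0 ∈ (L.box a₀).source) (H : L.Deforms l f a₀ τ K₁)
    {a : L.ι} {t₀ : L.T a} (hfa : MapsTo f K₂ (L.plaque a t₀))
    (hconn : IsConnected (K₁ ∩ K₂)) (hcrit : ∀ ζ ∈ K₁ ∩ K₂, ¬ L.IsCritical f ζ) :
    L.Deforms l f a₀ τ (K₁ ∪ K₂) := by
  classical
  obtain ⟨U', hU'o, hK₁U', h, H', Htag⟩ := H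
  obtain ⟨U, hU, hUo, hK₁U, hUΩ⟩ : ∃ U, U = U' ∩ Ω ∧ IsOpen U ∧ K₁ ⊆ U ∧ U ⊆ Ω :=
    ⟨_, rfl, hU'o.inter hΩ, subset_inter hK₁U' hK₁, inter_subset_right⟩
  have H : L.Approximates l f h U := H'.mono (hU ▸ inter_subset_left)
  obtain ⟨p, hp⟩ := hconn.nonempty
  set F : ℂ → ℂ := fun w => (L.box a (f w)).1 with hF
  set O := {ζ ∈ Ω | f ζ ∈ L.plaque a t₀} with hO
  have hOo : IsOpen O := isOpen_setOf_mem_plaque hΩ hf a t₀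
  have hK₂O : K₂ ⊆ O := fun ζ hζ => ⟨hK₂ hζ, hfa hζ⟩
  have hFd : DifferentiableOn ℂ F O := fun ζ hζ =>
    (hf ζ hζ.1 a hζ.2.1).2.differentiableWithinAt
  have hF'd : DifferentiableOn ℂ (deriv F) O := hFd.deriv hOo
  have hFa : ∀ ζ ∈ O, DifferentiableAt ℂ F ζ := fun ζ hζ => hFd.differentiableAt (hOo.mem_nhds hζ)
  have hF'a : ∀ ζ ∈ O, DifferentiableAt ℂ (deriv F) ζ := fun ζ hζ =>
    hF'd.differentiableAt (hOo.mem_nhds hζ)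
  obtain ⟨W, hW, hWo⟩ : ∃ W, W = U ∩ (O ∩ deriv F ⁻¹' {0}ᶜ) ∧ IsOpen W :=
    ⟨_, rfl, hUo.inter (hF'd.continuousOn.isOpen_inter_preimage hOo isOpen_compl_singleton)⟩
  have hKW : K₁ ∩ K₂ ⊆ W := fun ζ hζ => hW ▸ ⟨hK₁U hζ.1, hK₂O hζ.2, fun h1 =>
    hcrit ζ hζ ⟨a, (hfa hζ.2).1, h1⟩⟩
  have h₁₂ : IsCompact (K₁ ∩ K₂) := h₁.inter h₂
  -- `A` and `B` lie within `δ` of `K₁` and `K₂`. A correction of size at most `δ` moves points into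
  -- the `2 * δ` thickening, whose closed version over `K₁ ∩ K₂` is the compact set `C2`. The open
  -- `3 * δ` thickening leaves room for convergence of derivatives on `C2`.
  obtain ⟨δ, hδ, hδ1, hδ2, hδ3⟩ : ∃ δ > 0, cthickening (3 * δ) K₁ ⊆ U ∧
      cthickening (3 * δ) K₂ ⊆ O ∧ cthickening (3 * δ) (K₁ ∩ K₂) ⊆ W := by
    obtain ⟨δ₁, hδ₁, e₁⟩ := h₁.exists_cthickening_subset_open hUo hK₁U
    obtain ⟨δ₂, hδ₂, e₂⟩ := h₂.exists_cthickening_subset_open hOo hK₂O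
    obtain ⟨δ₃, hδ₃, e₃⟩ := h₁₂.exists_cthickening_subset_open hWo hKW
    have m : 3 * (min δ₁ (min δ₂ δ₃) / 3) = min δ₁ (min δ₂ δ₃) := by ring
    refine ⟨min δ₁ (min δ₂ δ₃) / 3, by positivity, ?_, ?_, ?_⟩ <;> rw [m]
    · exact (cthickening_mono (min_le_left _ _) _).trans e₁
    · exact (cthickening_mono ((min_le_right _ _).trans (min_le_left _ _)) _).trans e₂
    · exact (cthickening_mono ((min_le_right _ _).trans (min_le_right _ _)) _).trans e₃
  have hthick : ∀ (K : Set ℂ) ζ w, ζ ∈ thickening δ K → dist w ζ ≤ δ →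
      w ∈ thickening (2 * δ) K := by
    intro K ζ w hζ hw
    obtain ⟨k, hk, hd⟩ := mem_thickening_iff.1 hζ
    exact mem_thickening_iff.2 ⟨k, hk, by linarith [dist_triangle w ζ k]⟩
  have hsub23 : ∀ K : Set ℂ, thickening (2 * δ) K ⊆ cthickening (3 * δ) K := fun K =>
    (thickening_mono (by linarith) K).trans (thickening_subset_cthickening _ _)
  obtain ⟨A, B, hA, hB, hKA, hKB, hAδ, hBδ, hAB, χ, hχ, h01, hχ0, hχ1⟩ :=
    exists_splitting_cover h₁ h₂ hδ
  have hbdd : ∀ {K S : Set ℂ}, IsCompact K → S ⊆ thickening δ K → Bornology.IsBounded S :=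
    fun hK hS => hK.isBounded.thickening.subset hS
  obtain ⟨C, hC, κ, hκ, hsplit⟩ :=
    exists_nonlinear_splitting hA hB (hbdd h₁ hAδ) (hbdd h₂ hBδ) hχ h01 hχ0 hχ1
  set C2 := cthickening (2 * δ) (K₁ ∩ K₂) with hC2
  set N3 := thickening (3 * δ) (K₁ ∩ K₂) with hN3
  have hC2c : IsCompact C2 := h₁₂.cthickening
  have hC2N : C2 ⊆ N3 := cthickening_subset_thickening' (by positivity) (by linarith) _
  have hN3W : N3 ⊆ W := (thickening_subset_cthickening _ _).trans hδ3
  have hWO : W ⊆ O := hW ▸ fun ζ hζ => hζ.2.1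
  have hWU : W ⊆ U := hW ▸ fun ζ hζ => hζ.1
  have hWF : ∀ ζ ∈ W, deriv F ζ ≠ 0 := fun ζ hζ => by
    rw [hW] at hζ
    exact hζ.2.2
  have hC2O : C2 ⊆ O := (hC2N.trans hN3W).trans hWO
  have hABC2 : A ∩ B ⊆ C2 := by
    rw [hAB]
    exact (thickening_mono (by linarith) _).trans (thickening_subset_cthickening _ _)
  -- Bounds for `F` and its derivative
  obtain ⟨m, hm, hmF⟩ : ∃ m > 0, ∀ ζ ∈ C2, m ≤ ‖deriv F ζ‖ := by
    obtain ⟨z, hz, hzm⟩ := hC2c.exists_isMinOn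
      ⟨p, self_subset_cthickening _ hp⟩ (hF'd.continuousOn.mono hC2O).norm
    exact ⟨‖deriv F z‖, norm_pos_iff.2 (hWF z (hN3W (hC2N hz))), fun ζ hζ => hzm hζ⟩
  -- The condition `‖1 - Φ' w / F' ζ‖ ≤ κ` follows from `‖F' ζ - Φ' w‖ ≤ m * κ`. Half of this is the
  -- oscillation of `F'` at scale `η`, and the other half the convergence of `Φ'` to `F'`.
  obtain ⟨η, hη, hηδ, hηF⟩ : ∃ η > 0, η ≤ δ ∧ ∀ ζ ∈ C2, ∀ w ∈ C2, dist w ζ ≤ η →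
      ‖deriv F w - deriv F ζ‖ ≤ m * κ / 2 := by
    have huc := hC2c.uniformContinuousOn_of_continuous (hF'd.continuousOn.mono hC2O)
    obtain ⟨η, hη, hηF⟩ := Metric.uniformContinuousOn_iff.1 huc (m * κ / 2) (by positivity)
    refine ⟨min (η / 2) δ, by positivity, min_le_right _ _, fun ζ hζ w hw hd => ?_⟩
    rw [← dist_eq_norm]
    exact (hηF w hw ζ hζ (by linarith [min_le_left (η / 2) δ])).le
  have hBc : IsCompact (cthickening δ K₂) := h₂.cthickening
  have hBc' : B ⊆ cthickening δ K₂ := hBδ.trans (thickening_subset_cthickening _ _)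
  have hBcO : cthickening δ K₂ ⊆ O := (cthickening_mono (by linarith) _).trans hδ2
  have hBO : B ⊆ O := hBc'.trans hBcO
  -- The margin `μ` keeps `F + F' β` inside the unit disc, hence inside the flow box.
  obtain ⟨μ, hμ, hμF⟩ : ∃ μ > 0, ∀ ζ ∈ B, ‖F ζ‖ ≤ 1 - μ := by
    obtain ⟨z, hz, hzm⟩ := hBc.exists_isMaxOn
      ⟨p, self_subset_cthickening _ hp.2⟩ (hFd.continuousOn.mono hBcO).norm
    have h1 := box_fst_mem_ball (hBcO hz).2.1
    rw [mem_ball_zero_iff] at h1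
    exact ⟨1 - ‖F z‖, sub_pos.2 h1, fun ζ hζ => by simpa using hzm (hBc' hζ)⟩
  obtain ⟨D, hD⟩ : ∃ D, ∀ ζ ∈ B, ‖deriv F ζ‖ ≤ D := by
    obtain ⟨D, hD⟩ := hBc.exists_bound_of_continuousOn (hF'd.continuousOn.mono hBcO)
    exact ⟨D, fun ζ hζ => hD ζ (hBc' hζ)⟩
  -- Convergence in the flow box
  have hloc := (H.mono (hN3W.trans hWU)).tendstoLocallyUniformlyOn
    (fun ζ hζ => hf ζ (hUΩ (hWU (hN3W hζ)))) (a := a) fun ζ hζ => (hWO (hN3W hζ)).2.1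
  have hsrc : ∀ᶠ y in l, ∀ ζ ∈ N3, h y ζ ∈ (L.box a).source := by
    filter_upwards [H.eventually_mapsTo h₁₂.cthickening (hδ3.trans hWU) (L.box a).open_source
      fun ζ hζ => (hWO (hδ3 hζ)).2.1] with y hy ζ hζ
    exact hy (thickening_subset_cthickening _ _ hζ)
  have hGd : ∀ᶠ y in l, DifferentiableOn ℂ (fun w => (L.box a (h y w)).1) N3 := by
    filter_upwards [H.holAt, hsrc] with y hy hs ζ hζ
    exact (hy ζ (hWU (hN3W hζ)) a (hs ζ hζ)).2.differentiableWithinAt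
  have hlocC := (tendstoLocallyUniformlyOn_iff_forall_isCompact isOpen_thickening).1 hloc
    C2 hC2N hC2c
  have hlocD := (tendstoLocallyUniformlyOn_iff_forall_isCompact isOpen_thickening).1
    (hloc.deriv hGd isOpen_thickening) C2 hC2N hC2c
  obtain ⟨ε, hε0, hε, hεG⟩ := hlocC.exists_rate
  have hDG := Metric.tendstoUniformlyOn_iff.1 hlocD (m * κ / 2) (by positivity)
  have hCε : Tendsto (fun y => C * (ε y / m)) l (𝓝 0) := by
    simpa using (hε.div_const m).const_mul C
  have hDε : Tendsto (fun y => D * (C * (ε y / m))) l (𝓝 0) := by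
    simpa using hCε.const_mul D
  -- Solution of the gluing problem
  have hsol : ∀ y, ∃ α β : ℂ → ℂ, (C * (ε y / m) ≤ η ∧ (∀ ζ ∈ N3, h y ζ ∈ (L.box a).source) ∧
      DifferentiableOn ℂ (fun w => (L.box a (h y w)).1) N3 ∧
      (∀ ζ ∈ C2, dist (L.box a (h y ζ)).1 (F ζ) ≤ ε y) ∧
      (∀ ζ ∈ C2, dist (deriv F ζ) (deriv (fun w => (L.box a (h y w)).1) ζ) < m * κ / 2)) →
      DifferentiableOn ℂ α A ∧ DifferentiableOn ℂ β B ∧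
        (∀ ζ ∈ A, ‖α ζ‖ ≤ C * (ε y / m)) ∧ (∀ ζ ∈ B, ‖β ζ‖ ≤ C * (ε y / m)) ∧
        ∀ ζ ∈ A ∩ B, F ζ + deriv F ζ * β ζ = (L.box a (h y (ζ + α ζ))).1 := by
    intro y
    -- The corrections are chosen for every `y`; where the estimates fail the value `0` is
    -- arbitrary, since by `hP` they hold eventually.
    by_cases hy : C * (ε y / m) ≤ η ∧ (∀ ζ ∈ N3, h y ζ ∈ (L.box a).source) ∧
      DifferentiableOn ℂ (fun w => (L.box a (h y w)).1) N3 ∧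
      (∀ ζ ∈ C2, dist (L.box a (h y ζ)).1 (F ζ) ≤ ε y) ∧
      (∀ ζ ∈ C2, dist (deriv F ζ) (deriv (fun w => (L.box a (h y w)).1) ζ) < m * κ / 2)
    swap
    · exact ⟨0, 0, fun h => absurd h hy⟩
    obtain ⟨y1, -, y2, y3, y4⟩ := hy
    obtain ⟨α, β, hαβ⟩ := hsplit F (fun w => (L.box a (h y w)).1) η (ε y / m)
      (div_nonneg (hε0 y) hm.le) y1 (fun ζ hζ => by
        have hζ2 := hABC2 hζ
        have hne := hWF ζ (hN3W (hC2N hζ2))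
        refine ⟨hFa ζ (hC2O hζ2), hF'a ζ (hC2O hζ2), hne, ?_, fun w hw => ?_⟩
        · rw [norm_div, ← dist_eq_norm]
          exact div_le_div₀ (hε0 y) (y3 ζ hζ2) hm (hmF ζ hζ2)
        · have hwd : dist w ζ ≤ η := hw
          have hw2 : w ∈ C2 := thickening_subset_cthickening _ _
            (hthick _ ζ w (hAB ▸ hζ) (hwd.trans hηδ))
          refine ⟨y2.differentiableAt (isOpen_thickening.mem_nhds (hC2N hw2)), ?_⟩
          have e1 := hηF ζ hζ2 w hw2 hwd
          have e2 := y4 w hw2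
          rw [dist_eq_norm] at e2
          rw [one_sub_div hne, norm_div, div_le_iff₀ (norm_pos_iff.2 hne)]
          have e3 := norm_sub_le_norm_sub_add_norm_sub (deriv F ζ) (deriv F w)
            (deriv (fun w => (L.box a (h y w)).1) w)
          rw [norm_sub_rev (deriv F ζ) (deriv F w)] at e3
          have e4 : κ * m ≤ κ * ‖deriv F ζ‖ :=
            mul_le_mul_of_nonneg_left (hmF ζ hζ2) hκ.le
          linarith)
    exact ⟨α, β, fun _ => hαβ⟩
  choose α β hαβ using hsol
  have hP : ∀ᶠ y in l, C * (ε y / m) ≤ η ∧ (∀ ζ ∈ N3, h y ζ ∈ (L.box a).source) ∧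
      DifferentiableOn ℂ (fun w => (L.box a (h y w)).1) N3 ∧
      (∀ ζ ∈ C2, dist (L.box a (h y ζ)).1 (F ζ) ≤ ε y) ∧
      (∀ ζ ∈ C2, dist (deriv F ζ) (deriv (fun w => (L.box a (h y w)).1) ζ) < m * κ / 2) :=
    (hCε.eventually (ge_mem_nhds hη)).and (hsrc.and (hGd.and (hεG.and hDG)))
  -- The new plaque is the one that contains `h y p`. As `N3` is connected, `h y` maps all of `N3`
  -- into it, so the two formulas agree on `A ∩ B`.
  set h' : Y → ℂ → X := fun y ζ => if ζ ∈ A then h y (ζ + α y ζ) else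
    (L.box a).symm (F ζ + deriv F ζ * β y ζ, (L.box a (h y p)).2) with hh'
  have hmemU : ∀ y, (∀ ζ ∈ A, ‖α y ζ‖ ≤ C * (ε y / m)) → C * (ε y / m) ≤ η → ∀ ζ ∈ A,
      ζ + α y ζ ∈ U := fun y h1 h2 ζ hζ =>
    hδ1 (hsub23 _ (hthick _ ζ _ (hAδ hζ) (by
      rw [dist_self_add_left]
      exact ((h1 ζ hζ).trans h2).trans hηδ)))
  have hA' : ∀ y, ∀ ζ ∈ A, h' y ζ = h y (ζ + α y ζ) := fun y ζ hζ => if_pos hζ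
  have hB' : ∀ᶠ y in l, ∀ ζ ∈ B, h' y ζ =
      (L.box a).symm (F ζ + deriv F ζ * β y ζ, (L.box a (h y p)).2) := by
    filter_upwards [hP, H.holAt] with y hy hhol ζ hζ
    obtain ⟨-, -, b1, -, b3⟩ := hαβ y hy
    by_cases hζA : ζ ∈ A
    · rw [hA' y ζ hζA, b3 ζ ⟨hζA, hζ⟩]
      have hmem : ζ + α y ζ ∈ N3 := hC2N (thickening_subset_cthickening _ _
        (hthick _ ζ _ (hAB ▸ ⟨hζA, hζ⟩) (by
          rw [dist_self_add_left]
          exact ((b1 ζ hζA).trans hy.1).trans hηδ)))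
      refine (box_symm_of_mem_plaque ⟨hy.2.1 _ hmem, ?_⟩).symm
      exact snd_box_eq_of_isPreconnected
        (isPreconnected_thickening hconn.isPreconnected (by positivity))
        (fun w hw => hhol w (hWU (hN3W hw))) hy.2.1 hmem
        (self_subset_thickening (by positivity) _ hp)
    · exact if_neg hζA
  have hα0 : ∀ ζ ∈ A, Tendsto (fun q : Y × ℂ => α q.1 q.2) (l ×ˢ 𝓝 ζ) (𝓝 0) := fun ζ hζ => by
    refine squeeze_zero_norm' ?_ (hCε.comp tendsto_fst)
    filter_upwards [tendsto_fst.eventually hP,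
      tendsto_snd.eventually (hA.eventually_mem hζ)] with q hq hqA
    exact (hαβ q.1 hq).2.2.1 q.2 hqA
  have hβ0 : ∀ ζ ∈ B, Tendsto (fun q : Y × ℂ => β q.1 q.2) (l ×ˢ 𝓝 ζ) (𝓝 0) := fun ζ hζ => by
    refine squeeze_zero_norm' ?_ (hCε.comp tendsto_fst)
    filter_upwards [tendsto_fst.eventually hP,
      tendsto_snd.eventually (hB.eventually_mem hζ)] with q hq hqB
    exact (hαβ q.1 hq).2.2.2.1 q.2 hqB
  have hAU : A ⊆ U := fun ζ hζ => hδ1 (hsub23 _ (hthick _ ζ ζ (hAδ hζ) (by simpa using hδ.le)))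
  refine ⟨A ∪ B, hA.union hB, union_subset_union hKA hKB, h', ⟨?_, ?_⟩, ?_⟩
  · filter_upwards [hP, hB', H.holAt, hDε.eventually (ge_mem_nhds (half_pos hμ))] with
      y hy hyB hhol hyD
    obtain ⟨a1, a2, b1, b2, b3⟩ := hαβ y hy
    rintro ζ (hζ | hζ)
    · have h1 : L.HolAt (fun z => h y (z + α y z)) ζ :=
        (hhol _ (hmemU y b1 hy.1 ζ hζ)).comp (α := fun z => z + α y z)
          (differentiableAt_id.add (a1.differentiableAt (hA.mem_nhds hζ)))
      refine h1.congr ?_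
      filter_upwards [hA.mem_nhds hζ] with w hw using hA' y w hw
    · have h1 : L.HolAt (fun z => (L.box a).symm (F z + deriv F z * β y z,
          (L.box a (h y p)).2)) ζ := by
        refine holAt_box_symm _ ((hFa ζ (hBO hζ)).add
          ((hF'a ζ (hBO hζ)).mul (a2.differentiableAt (hB.mem_nhds hζ)))) ?_
        rw [mem_ball_zero_iff]
        have e1 := norm_add_le (F ζ) (deriv F ζ * β y ζ)
        have e2 : ‖deriv F ζ * β y ζ‖ ≤ D * (C * (ε y / m)) := by
          rw [norm_mul]
          exact mul_le_mul (hD ζ hζ) (b2 ζ hζ) (norm_nonneg _)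
            ((norm_nonneg _).trans (hD ζ hζ))
        linarith [hμF ζ hζ]
      refine h1.congr ?_
      filter_upwards [hB.mem_nhds hζ] with w hw using hyB w hw
  · rintro ζ (hζ | hζ)
    · have h1 : Tendsto (fun q : Y × ℂ => (q.1, q.2 + α q.1 q.2)) (l ×ˢ 𝓝 ζ) (l ×ˢ 𝓝 ζ) :=
        tendsto_fst.prodMk (by simpa using (tendsto_snd (f := l) (g := 𝓝 ζ)).add (hα0 ζ hζ))
      refine ((H.tendsto ζ (hAU hζ)).comp h1).congr' ?_
      filter_upwards [tendsto_snd.eventually (hA.eventually_mem hζ)] with q hq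
      exact (hA' q.1 q.2 hq).symm
    · have hpU : p ∈ U := hK₁U hp.1
      have h1 : Tendsto (fun y => (L.box a (h y p)).2) l (𝓝 t₀) := by
        have h2 := (H.tendsto_box hpU (hfa hp.2).1).comp
          (tendsto_id.prodMk (tendsto_const_nhds (x := p) (f := l)))
        have h3 := (continuous_snd.tendsto _).comp h2
        rwa [(hfa hp.2).2] at h3
      have h2 : Tendsto (fun q : Y × ℂ => F q.2 + deriv F q.2 * β q.1 q.2) (l ×ˢ 𝓝 ζ)
          (𝓝 (F ζ)) := by
        have := ((hFa ζ (hBO hζ)).continuousAt.tendsto.comp (tendsto_snd (f := l))).add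
          (((hF'a ζ (hBO hζ)).continuousAt.tendsto.comp (tendsto_snd (f := l))).mul (hβ0 ζ hζ))
        simpa using this
      have h3 := ((L.box a).continuousAt_symm
        (mem_box_target (box_fst_mem_ball (hBO hζ).2.1) t₀)).tendsto.comp
        (h2.prodMk_nhds (h1.comp tendsto_fst))
      rw [box_symm_of_mem_plaque (hBO hζ).2] at h3
      refine h3.congr' ?_
      filter_upwards [tendsto_fst.eventually hB',
        tendsto_snd.eventually (hB.eventually_mem hζ)] with q hq hqB
      exact (hq q.2 hqB).symm
  -- The reparametrization moves `0` only within a ball that `h y` maps into the flow box `a₀`, so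
  -- the plaque of the value at `0` is unchanged.
  · have hf0c := (hf 0 (hK₁ h0)).continuousAt
    obtain ⟨r, hr, hrU⟩ := Metric.nhds_basis_closedBall.mem_iff.1
      (inter_mem (hUo.mem_nhds (hK₁U h0)) (hf0c.preimage_mem_nhds
        ((L.box a₀).open_source.mem_nhds hf0)))
    filter_upwards [hP, Htag, H.holAt, hCε.eventually (ge_mem_nhds hr),
      H.eventually_mapsTo (isCompact_closedBall 0 r) (fun ζ hζ => (hrU hζ).1)
        (L.box a₀).open_source fun ζ hζ => (hrU hζ).2] with y hy htag hhol hyr hys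
    rw [hA' y 0 (hKA h0)]
    have hmem : 0 + α y 0 ∈ closedBall (0 : ℂ) r := by
      simpa using ((hαβ y hy).2.2.1 0 (hKA h0)).trans hyr
    refine ⟨hys hmem, ?_⟩
    rw [← htag.2]
    exact snd_box_eq_of_isPreconnected (convex_closedBall 0 r).isPreconnected
      (fun w hw => hhol w (hrU hw).1) hys hmem (mem_closedBall_self hr.le)

end RiemannSurfaceLamination

/-! ### Filling a rectangle by small cells with overlaps free of critical points. -/

/-- Induction along an interval, by steps of length at most `δ` that start outside `Z`. -/
theorem Set.Countable.interval_induction {Z : Set ℝ} (hZ : Z.Countable) {δ s₀ d : ℝ} (hδ : 0 < δ)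
    {Q : ℝ → Prop} (h₀ : s₀ ∉ Z) (hQ₀ : Q s₀)
    (hQ : ∀ s s', s₀ ≤ s → s ≤ s' → s' ≤ s + δ → s' ≤ d → s ∉ Z → Q s → Q s') {s : ℝ}
    (hs : s₀ ≤ s) (hsd : s ≤ d) : Q s := by
  have key : ∀ n : ℕ, ∀ s, s₀ ≤ s → s ≤ d → s ≤ s₀ + n * (δ / 2) → Q s := by
    intro n
    induction n with
    | zero =>
      intro s hs _ hn
      have : s = s₀ := le_antisymm (by simpa using hn) hs
      rwa [this]
    | succ n ih =>
      intro s hs hsd hn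
      by_cases h1 : s ≤ s₀ + δ
      · exact hQ s₀ s le_rfl hs h1 hsd h₀ hQ₀
      · push Not at h1
        -- One step from `m` reaches `s`, and `m` lies more than `δ / 2` below `s`, so finitely many
        -- steps suffice. Only starting points must avoid `Z`; the end `s` may lie in it.
        obtain ⟨m, hm, hmZ⟩ := (hZ.dense_compl ℝ).exists_between (show s - δ < s - δ / 2 by linarith)
        refine hQ m s (by linarith [hmZ.1]) (by linarith [hmZ.2]) (by linarith [hmZ.1]) hsd hm
          (ih m (by linarith [hmZ.1]) (by linarith [hmZ.2]) ?_)
        push_cast at hn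
        linarith [hmZ.2]
  obtain ⟨n, hn⟩ := exists_nat_ge ((s - s₀) / (δ / 2))
  refine key n s hs hsd ?_
  rw [div_le_iff₀ (half_pos hδ)] at hn
  linarith

theorem isConnected_Icc_reProdIm {a b c d : ℝ} (hab : a ≤ b) (hcd : c ≤ d) :
    IsConnected (Icc a b ×ℂ Icc c d) :=
  ⟨⟨⟨a, c⟩, left_mem_Icc.2 hab, left_mem_Icc.2 hcd⟩,
    (((convex_Icc a b).linear_preimage Complex.reCLM.toLinearMap).inter
      ((convex_Icc c d).linear_preimage Complex.imCLM.toLinearMap)).isPreconnected⟩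

namespace RiemannSurfaceLamination

variable {X : Type u} [TopologicalSpace X] {L : RiemannSurfaceLamination.{u, v, w} X}

/-- The preimages of plaques are open in the plane and cover `R`; `δ` is a Lebesgue number of this
cover. -/
theorem exists_forall_mapsTo_plaque {f : ℂ → X} {Ω R : Set ℂ} (hΩ : IsOpen Ω)
    (hf : ∀ ζ ∈ Ω, L.HolAt f ζ) (hR : IsCompact R) (hRΩ : R ⊆ Ω) :
    ∃ δ > 0, ∀ ζ ∈ R, ∃ (a : L.ι) (t : L.T a), MapsTo f (ball ζ δ) (L.plaque a t) := by
  obtain ⟨δ, hδ, h⟩ := lebesgue_number_lemma_of_metric hR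
    (c := fun i : (a : L.ι) × L.T a => {ζ ∈ Ω | f ζ ∈ L.plaque i.1 i.2})
    (fun i => isOpen_setOf_mem_plaque hΩ hf i.1 i.2) (fun ζ hζ => by
      obtain ⟨a, ha⟩ := L.cover (f ζ)
      exact mem_iUnion.2 ⟨⟨a, (L.box a (f ζ)).2⟩, hRΩ hζ, ha, rfl⟩)
  refine ⟨δ, hδ, fun ζ hζ => ?_⟩
  obtain ⟨i, hi⟩ := h ζ hζ
  exact ⟨i.1, i.2, fun w hw => (hi hw).2⟩

/-- Deformations extend from a rectangle to a wider rectangle. The rectangles are rotated by the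
multiplication by `e`, and `E` contains the coordinates of the critical points. -/
theorem Deforms.extend_rectangle {Y : Type*} {l : Filter Y} {f : ℂ → X} {a₀ : L.ι}
    {τ : Y → L.T a₀} {Ω : Set ℂ} (hΩ : IsOpen Ω) (hf : ∀ ζ ∈ Ω, L.HolAt f ζ)
    (hf0 : f 0 ∈ (L.box a₀).source) {e : ℂ} (he : ‖e‖ = 1) {E : Set ℝ} (hE : E.Countable)
    (hcrit : ∀ z, e * z ∈ Ω → L.IsCritical f (e * z) → z.re ∈ E ∧ z.im ∈ E)
    {a b b' c d : ℝ} (ha : a ≤ 0) (hb : 0 ≤ b) (hbb' : b ≤ b') (hc : c ≤ 0) (hd : 0 ≤ d)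
    (hbE : b ∉ E) (hcE : c ∉ E) (hRΩ : MapsTo (e * ·) (Icc a b' ×ℂ Icc c d) Ω)
    (H : L.Deforms l f a₀ τ ((e * ·) '' (Icc a b ×ℂ Icc c d))) :
    L.Deforms l f a₀ τ ((e * ·) '' (Icc a b' ×ℂ Icc c d)) := by
  have hcont : Continuous (e * ·) := continuous_const.mul continuous_id
  have he0 : e ≠ 0 := norm_pos_iff.1 (he ▸ one_pos)
  have hinj : Function.Injective (e * ·) := mul_right_injective₀ he0
  have hcd : c ≤ d := hc.trans hd
  have hrc : ∀ p q r s : ℝ, IsCompact (Icc p q ×ℂ Icc r s) := fun p q r s =>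
    isCompact_Icc.reProdIm isCompact_Icc
  obtain ⟨δ, hδ, hδf⟩ := exists_forall_mapsTo_plaque hΩ hf ((hrc a b' c d).image hcont)
    hRΩ.image_subset
  have glue : ∀ P₁ P₂ : Set ℂ, IsCompact P₁ → IsCompact P₂ → P₁ ⊆ Icc a b' ×ℂ Icc c d →
      P₂ ⊆ Icc a b' ×ℂ Icc c d → 0 ∈ P₁ → ∀ z₀ ∈ P₂, (∀ z ∈ P₂, ‖z - z₀‖ < δ) →
      IsConnected (P₁ ∩ P₂) → (∀ z ∈ P₁ ∩ P₂, z.re ∉ E ∨ z.im ∉ E) →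
      L.Deforms l f a₀ τ ((e * ·) '' P₁) → L.Deforms l f a₀ τ ((e * ·) '' (P₁ ∪ P₂)) := by
    intro P₁ P₂ h₁ h₂ hP₁ hP₂ h0 z₀ hz₀ hsmall hconn hE' HP
    obtain ⟨i, t, hit⟩ := hδf (e * z₀) (mem_image_of_mem _ (hP₂ hz₀))
    rw [image_union]
    refine Deforms.union hΩ hf (h₁.image hcont) (h₂.image hcont)
      (hRΩ.mono_left hP₁).image_subset (hRΩ.mono_left hP₂).image_subset
      ⟨0, h0, mul_zero _⟩ hf0 HP (a := i) (t₀ := t) ?_ ?_ ?_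
    · rintro _ ⟨z, hz, rfl⟩
      refine hit ?_
      rw [mem_ball, dist_eq_norm, ← mul_sub, norm_mul, he, one_mul]
      exact hsmall z hz
    · rw [← image_inter hinj]
      exact hconn.image _ hcont.continuousOn
    · rw [← image_inter hinj]
      rintro _ ⟨z, hz, rfl⟩ hcr
      have := hcrit z (hRΩ (hP₁ hz.1)) hcr
      exact (hE' z hz).elim (fun h => h this.1) fun h => h this.2
  have hsmall : ∀ m m' s s' : ℝ, m' ≤ m + δ / 3 → s' ≤ s + δ / 3 →
      ∀ z ∈ Icc m m' ×ℂ Icc s s', ‖z - ⟨m, s⟩‖ < δ := by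
    rintro m m' s s' hm hs z ⟨⟨h1, h2⟩, h3, h4⟩
    refine (Complex.norm_le_abs_re_add_abs_im _).trans_lt ?_
    simp only [Complex.sub_re, Complex.sub_im]
    rw [abs_of_nonneg (by linarith), abs_of_nonneg (by linarith)]
    linarith
  have hzero : ∀ m, b ≤ m → (0 : ℂ) ∈ Icc a m ×ℂ Icc c d := fun m hm =>
    ⟨⟨ha, hb.trans hm⟩, hc, hd⟩
  have column : ∀ m m', b ≤ m → m ≤ m' → m' ≤ m + δ / 3 → m' ≤ b' → m ∉ E →
      L.Deforms l f a₀ τ ((e * ·) '' (Icc a m ×ℂ Icc c d)) →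
      L.Deforms l f a₀ τ ((e * ·) '' (Icc a m' ×ℂ Icc c d)) := by
    intro m m' hbm hmm' hm'δ hm'b hmE Hm
    have ham : a ≤ m := ha.trans (hb.trans hbm)
    have hleft : Icc a m ×ℂ Icc c d ⊆ Icc a b' ×ℂ Icc c d := fun z hz =>
      ⟨⟨hz.1.1, hz.1.2.trans (hmm'.trans hm'b)⟩, hz.2⟩
    have hright : ∀ r s, c ≤ r → s ≤ d → Icc m m' ×ℂ Icc r s ⊆ Icc a b' ×ℂ Icc c d :=
      fun r s hr hs z hz =>
        ⟨⟨ham.trans hz.1.1, hz.1.2.trans hm'b⟩, hr.trans hz.2.1, hz.2.2.trans hs⟩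
    have hQ : L.Deforms l f a₀ τ
        ((e * ·) '' (Icc a m ×ℂ Icc c d ∪ Icc m m' ×ℂ Icc c d)) := by
      -- The column is built upwards from a degenerate cell, its bottom edge, which meets the old
      -- rectangle only at the corner `(m, c)`. With both sides at most `δ / 3`, each cell lies in a
      -- single plaque.
      refine hE.interval_induction (δ := δ / 3) (s₀ := c) (d := d) (Q := fun s =>
        L.Deforms l f a₀ τ ((e * ·) '' (Icc a m ×ℂ Icc c d ∪ Icc m m' ×ℂ Icc c s)))
        (by positivity) hcE ?_ ?_ hcd le_rfl
      · have hint : Icc a m ×ℂ Icc c d ∩ Icc m m' ×ℂ Icc c c = Icc m m ×ℂ Icc c c := by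
          ext z
          constructor
          · rintro ⟨⟨h1, -⟩, h2, h3⟩
            exact ⟨⟨h2.1, h1.2⟩, h3⟩
          · rintro ⟨h1, h2⟩
            exact ⟨⟨⟨ham.trans h1.1, h1.2⟩, h2.1, h2.2.trans hcd⟩, ⟨h1.1, h1.2.trans hmm'⟩, h2⟩
        refine glue _ _ (hrc _ _ _ _) (hrc _ _ _ _) hleft (hright c c le_rfl hcd) (hzero m hbm)
          ⟨m, c⟩ ⟨left_mem_Icc.2 hmm', left_mem_Icc.2 le_rfl⟩
          (hsmall m m' c c hm'δ (by linarith)) ?_ ?_ Hm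
        · rw [hint]
          exact isConnected_Icc_reProdIm le_rfl le_rfl
        · rw [hint]
          rintro z ⟨h1, -⟩
          left
          rwa [le_antisymm h1.2 h1.1]
      · intro s s' hcs hss' hsδ hs'd hsE Hs
        -- The overlap is the left edge and the bottom edge of the new cell. They share a corner,
        -- and they carry no critical point because `m ∉ E` and `s ∉ E`.
        have hint : (Icc a m ×ℂ Icc c d ∪ Icc m m' ×ℂ Icc c s) ∩ Icc m m' ×ℂ Icc s s' =
            Icc m m ×ℂ Icc s s' ∪ Icc m m' ×ℂ Icc s s := by
          ext z
          constructor
          · rintro ⟨⟨h1, -⟩ | ⟨-, h1⟩, h2, h3⟩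
            · exact Or.inl ⟨⟨h2.1, h1.2⟩, h3⟩
            · exact Or.inr ⟨h2, h3.1, h1.2⟩
          · rintro (⟨h1, h2⟩ | ⟨h1, h2⟩)
            · exact ⟨Or.inl ⟨⟨ham.trans h1.1, h1.2⟩, hcs.trans h2.1, h2.2.trans hs'd⟩,
                ⟨h1.1, h1.2.trans hmm'⟩, h2⟩
            · exact ⟨Or.inr ⟨h1, hcs.trans h2.1, h2.2⟩, h1, h2.1, h2.2.trans hss'⟩
        have hun : Icc a m ×ℂ Icc c d ∪ Icc m m' ×ℂ Icc c s' =
            (Icc a m ×ℂ Icc c d ∪ Icc m m' ×ℂ Icc c s) ∪ Icc m m' ×ℂ Icc s s' := by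
          rw [union_assoc]
          congr 1
          ext z
          constructor
          · rintro ⟨h1, h2⟩
            rcases le_total z.im s with h | h
            · exact Or.inl ⟨h1, h2.1, h⟩
            · exact Or.inr ⟨h1, h, h2.2⟩
          · rintro (⟨h1, h2⟩ | ⟨h1, h2⟩)
            · exact ⟨h1, h2.1, h2.2.trans hss'⟩
            · exact ⟨h1, hcs.trans h2.1, h2.2⟩
        simp only [hun]
        refine glue _ _ ((hrc _ _ _ _).union (hrc _ _ _ _)) (hrc _ _ _ _)
          (union_subset hleft (hright c s le_rfl (hss'.trans hs'd))) (hright s s' hcs hs'd)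
          (Or.inl (hzero m hbm)) ⟨m, s⟩ ⟨left_mem_Icc.2 hmm', left_mem_Icc.2 hss'⟩
          (hsmall m m' s s' hm'δ hsδ) ?_ ?_ Hs
        · rw [hint]
          exact (isConnected_Icc_reProdIm le_rfl hss').union
            ⟨⟨m, s⟩, ⟨left_mem_Icc.2 le_rfl, left_mem_Icc.2 hss'⟩,
              left_mem_Icc.2 hmm', left_mem_Icc.2 le_rfl⟩
            (isConnected_Icc_reProdIm hmm' le_rfl)
        · rw [hint]
          rintro z (⟨h1, -⟩ | ⟨-, h1⟩)
          · left
            rwa [le_antisymm h1.2 h1.1]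
          · right
            rwa [le_antisymm h1.2 h1.1]
    refine hQ.mono (image_mono ?_)
    rintro z ⟨h1, h2⟩
    rcases le_total z.re m with h | h
    · exact Or.inl ⟨⟨h1.1, h⟩, h2⟩
    · exact Or.inr ⟨⟨h, h1.2⟩, h2⟩
  exact hE.interval_induction (δ := δ / 3) (s₀ := b) (d := b')
    (Q := fun m => L.Deforms l f a₀ τ ((e * ·) '' (Icc a m ×ℂ Icc c d)))
    (by positivity) hbE H column hbb' le_rfl

/-- A holomorphic map from a strip to a leaf deforms to the nearby leaves, over any rectangle. -/
theorem deforms_rectangle {Y : Type*} {l : Filter Y} {f : ℂ → X} {a₀ : L.ι}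
    {τ : Y → L.T a₀} {ω : ℝ} (hf : ∀ ζ : ℂ, |ζ.im| < ω → L.HolAt f ζ)
    (hf0 : f 0 ∈ (L.box a₀).source) (hcrit : ¬ L.IsCritical f 0)
    (hτ : Tendsto τ l (𝓝 (L.box a₀ (f 0)).2)) {M N : ℝ} (hM : 0 < M) (hN : 0 < N) (hNω : N < ω) :
    L.Deforms l f a₀ τ (Icc (-M) M ×ℂ Icc (-N) N) := by
  set Ω : Set ℂ := {ζ | |ζ.im| < ω} with hΩ
  have hΩo : IsOpen Ω := isOpen_lt (continuous_abs.comp Complex.continuous_im) continuous_const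
  have hΩc : IsPreconnected Ω := by
    have : Ω = Complex.imCLM ⁻¹' Ioo (-ω) ω := by
      ext z
      simp [hΩ, abs_lt]
    rw [this]
    exact ((convex_Ioo (-ω) ω).linear_preimage Complex.imCLM.toLinearMap).isPreconnected
  have h0Ω : (0 : ℂ) ∈ Ω := by
    simpa [hΩ] using hN.trans hNω
  have hZ := countable_isCritical hΩo hΩc hf h0Ω hcrit
  set Z := {ζ ∈ Ω | L.IsCritical f ζ} with hZdef
  -- Closed under negation and containing both coordinates, `E` serves for all four rotations by
  -- `1`, `-1`, `I` and `-I`.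
  set E : Set ℝ := (Complex.re '' Z ∪ (fun z => -z.re) '' Z) ∪
    (Complex.im '' Z ∪ (fun z => -z.im) '' Z) with hEdef
  have hE : E.Countable :=
    ((hZ.image _).union (hZ.image _)).union ((hZ.image _).union (hZ.image _))
  have hEneg : ∀ x, x ∉ E → -x ∉ E := by
    intro x hx h
    refine hx ?_
    rcases h with (⟨z, hz, h⟩ | ⟨z, hz, h⟩) | (⟨z, hz, h⟩ | ⟨z, hz, h⟩)
    · exact Or.inl (Or.inr ⟨z, hz, by simp only; linarith⟩)
    · exact Or.inl (Or.inl ⟨z, hz, by simp only at h; linarith⟩)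
    · exact Or.inr (Or.inr ⟨z, hz, by simp only; linarith⟩)
    · exact Or.inr (Or.inl ⟨z, hz, by simp only at h; linarith⟩)
  -- In the vertical extensions `-M'` is the coordinate at which columns start, so it must avoid
  -- `E`. The height `N` is only an end point and needs no adjustment.
  obtain ⟨M', hM'E, hM'⟩ := (hE.dense_compl ℝ).exists_between (show M < M + 1 by linarith)
  set U₀ := {ζ ∈ Ω | f ζ ∈ L.plaque a₀ (L.box a₀ (f 0)).2} with hU₀
  have hU₀o : IsOpen U₀ := isOpen_setOf_mem_plaque hΩo hf _ _
  obtain ⟨ρ, hρ, hρU⟩ := Metric.isOpen_iff.1 hU₀o 0 ⟨h0Ω, hf0, rfl⟩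
  obtain ⟨ε, hεE, hε⟩ := (hE.dense_compl ℝ).exists_between
    (show 0 < min (ρ / 2) (min M' N) from
      lt_min (half_pos hρ) (lt_min (hM.trans hM'.1) hN))
  have hε0 : 0 < ε := hε.1
  have hερ : ε < ρ / 2 := hε.2.trans_le (min_le_left _ _)
  have hεM : ε < M' := hε.2.trans_le ((min_le_right _ _).trans (min_le_left _ _))
  have hεN : ε < N := hε.2.trans_le ((min_le_right _ _).trans (min_le_right _ _))
  have hM'0 : 0 < M' := hM.trans hM'.1
  -- From this small square inside one plaque, the rectangle grows to the right, to the left, up and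
  -- down, each time by `Deforms.extend_rectangle` after a rotation.
  have start : L.Deforms l f a₀ τ (Icc (-ε) ε ×ℂ Icc (-ε) ε) := by
    refine (deforms_of_mapsTo_plaque hτ hU₀o (fun ζ hζ => hf ζ hζ.1) (fun ζ hζ => hζ.2)
      ⟨h0Ω, hf0, rfl⟩).mono fun z hz => hρU ?_
    rw [mem_ball_zero_iff]
    refine (Complex.norm_le_abs_re_add_abs_im z).trans_lt ?_
    have h1 := abs_le.2 hz.1
    have h2 := abs_le.2 hz.2
    linarith
  have image_eq : ∀ e : ℂ, e ≠ 0 → ∀ S : Set ℂ, (e * ·) '' S = {z | e⁻¹ * z ∈ S} := by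
    intro e he S
    ext z
    constructor
    · rintro ⟨w, hw, rfl⟩
      simpa [he] using hw
    · exact fun hz => ⟨e⁻¹ * z, hz, by simp [he]⟩
  have image_neg : ∀ a b c d : ℝ, (-1 * ·) '' (Icc a b ×ℂ Icc c d) =
      Icc (-b) (-a) ×ℂ Icc (-d) (-c) := by
    intro a b c d
    rw [image_eq _ (by simp)]
    ext z
    have h1 : ((-1 : ℂ)⁻¹ * z).re = -z.re := by simp [inv_neg]
    have h2 : ((-1 : ℂ)⁻¹ * z).im = -z.im := by simp [inv_neg]
    simp only [mem_ofPred_eq, Complex.mem_reProdIm, mem_Icc, h1, h2]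
    grind
  have image_I : ∀ a b c d : ℝ, (Complex.I * ·) '' (Icc a b ×ℂ Icc c d) =
      Icc (-d) (-c) ×ℂ Icc a b := by
    intro a b c d
    rw [image_eq _ Complex.I_ne_zero]
    ext z
    have h1 : (Complex.I⁻¹ * z).re = z.im := by simp
    have h2 : (Complex.I⁻¹ * z).im = -z.re := by simp
    simp only [mem_ofPred_eq, Complex.mem_reProdIm, mem_Icc, h1, h2]
    grind
  have image_neg_I : ∀ a b c d : ℝ, (-Complex.I * ·) '' (Icc a b ×ℂ Icc c d) =
      Icc c d ×ℂ Icc (-b) (-a) := by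
    intro a b c d
    rw [image_eq _ (neg_ne_zero.2 Complex.I_ne_zero)]
    ext z
    have h1 : ((-Complex.I)⁻¹ * z).re = -z.im := by simp [inv_neg]
    have h2 : ((-Complex.I)⁻¹ * z).im = z.re := by simp [inv_neg]
    simp only [mem_ofPred_eq, Complex.mem_reProdIm, mem_Icc, h1, h2]
    grind
  have hΩmem : ∀ z : ℂ, |z.im| ≤ N → z ∈ Ω := fun z hz => hz.trans_lt hNω
  have step1 : L.Deforms l f a₀ τ (Icc (-ε) M' ×ℂ Icc (-ε) ε) := by
    have := Deforms.extend_rectangle (e := 1) (E := E) (a := -ε) (b := ε) (b' := M') (c := -ε)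
      (d := ε) hΩo hf hf0 (by simp) hE (fun z h1 h2 => by
        rw [one_mul] at h1 h2
        exact ⟨Or.inl (Or.inl ⟨z, ⟨h1, h2⟩, rfl⟩), Or.inr (Or.inl ⟨z, ⟨h1, h2⟩, rfl⟩)⟩)
      (by linarith) hε0.le hεM.le (by linarith) hε0.le hεE (hEneg _ hεE) (fun z hz => hΩmem _ (by
        simpa using (abs_le.2 hz.2).trans hεN.le)) (by simpa using start)
    simpa using this
  have step2 : L.Deforms l f a₀ τ (Icc (-M') M' ×ℂ Icc (-ε) ε) := by
    have := Deforms.extend_rectangle (e := -1) (E := E) (a := -M') (b := ε) (b' := M') (c := -ε)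
      (d := ε) hΩo hf hf0 (by simp) hE (fun z h1 h2 =>
        ⟨Or.inl (Or.inr ⟨-1 * z, ⟨h1, h2⟩, by simp⟩), Or.inr (Or.inr ⟨-1 * z, ⟨h1, h2⟩, by simp⟩)⟩)
      (by linarith) hε0.le hεM.le (by linarith) hε0.le hεE (hEneg _ hεE) (fun z hz => hΩmem _ (by
        simpa using (abs_le.2 hz.2).trans hεN.le)) (by rw [image_neg, neg_neg, neg_neg]; exact step1)
    rwa [image_neg, neg_neg, neg_neg] at this
  have step3 : L.Deforms l f a₀ τ (Icc (-M') M' ×ℂ Icc (-ε) N) := by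
    have := Deforms.extend_rectangle (e := Complex.I) (E := E) (a := -ε) (b := ε) (b' := N)
      (c := -M') (d := M') hΩo hf hf0 (by simp) hE (fun z h1 h2 =>
        ⟨Or.inr (Or.inl ⟨Complex.I * z, ⟨h1, h2⟩, by simp⟩),
          Or.inl (Or.inr ⟨Complex.I * z, ⟨h1, h2⟩, by simp⟩)⟩)
      (by linarith) hε0.le hεN.le (by linarith) hM'0.le hεE (hEneg _ hM'E)
      (fun z hz => hΩmem _ (by
        have h1 := hz.1.1
        have h2 := hz.1.2
        simpa using abs_le.2 ⟨by linarith, h2⟩)) (by rw [image_I, neg_neg]; exact step2)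
    rwa [image_I, neg_neg] at this
  have step4 : L.Deforms l f a₀ τ (Icc (-M') M' ×ℂ Icc (-N) N) := by
    have := Deforms.extend_rectangle (e := -Complex.I) (E := E) (a := -N) (b := ε) (b' := N)
      (c := -M') (d := M') hΩo hf hf0 (by simp) hE (fun z h1 h2 =>
        ⟨Or.inr (Or.inr ⟨-Complex.I * z, ⟨h1, h2⟩, by simp⟩),
          Or.inl (Or.inl ⟨-Complex.I * z, ⟨h1, h2⟩, by simp⟩)⟩)
      (by linarith) hε0.le hεN.le (by linarith) hM'0.le hεE (hEneg _ hM'E)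
      (fun z hz => hΩmem _ (by simpa using abs_le.2 hz.1))
      (by rw [image_neg_I, neg_neg]; exact step3)
    rwa [image_neg_I, neg_neg] at this
  exact step4.mono fun z hz => ⟨⟨by linarith [hz.1.1, hM'.1], by linarith [hz.1.2, hM'.1]⟩, hz.2⟩

end RiemannSurfaceLamination

/-! ### The conformal equivalence of strip and disc, and a Hurwitz theorem. -/

/-- A conformal map from the strip `|im| < π / 2` to the unit disc. -/
noncomputable def stripToDisc (w : ℂ) : ℂ := (Complex.exp w - 1) / (Complex.exp w + 1)

/-- The inverse of `stripToDisc`. -/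
noncomputable def discToStrip (z : ℂ) : ℂ := Complex.log ((1 + z) / (1 - z))

theorem exp_re_pos {w : ℂ} (hw : |w.im| < Real.pi / 2) : 0 < (Complex.exp w).re := by
  rw [Complex.exp_re]
  exact mul_pos (Real.exp_pos _) (Real.cos_pos_of_mem_Ioo (abs_lt.1 hw))

theorem exp_add_one_ne_zero {w : ℂ} (hw : |w.im| < Real.pi / 2) : Complex.exp w + 1 ≠ 0 := by
  intro h
  have := congrArg Complex.re h
  simp only [Complex.add_re, Complex.one_re, Complex.zero_re] at this
  linarith [exp_re_pos hw]

theorem stripToDisc_mem_ball {w : ℂ} (hw : |w.im| < Real.pi / 2) :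
    stripToDisc w ∈ ball (0 : ℂ) 1 := by
  have h1 := exp_re_pos hw
  rw [mem_ball_zero_iff, stripToDisc, norm_div,
    div_lt_one (norm_pos_iff.2 (exp_add_one_ne_zero hw))]
  rw [← sq_lt_sq₀ (norm_nonneg _) (norm_nonneg _), Complex.sq_norm, Complex.sq_norm,
    Complex.normSq_apply, Complex.normSq_apply]
  simp only [Complex.sub_re, Complex.sub_im, Complex.add_re, Complex.add_im, Complex.one_re,
    Complex.one_im]
  nlinarith

theorem differentiableAt_stripToDisc {w : ℂ} (hw : |w.im| < Real.pi / 2) :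
    DifferentiableAt ℂ stripToDisc w :=
  (Complex.differentiableAt_exp.sub_const 1).div (Complex.differentiableAt_exp.add_const 1)
    (exp_add_one_ne_zero hw)

theorem stripToDisc_zero : stripToDisc 0 = 0 := by simp [stripToDisc]

theorem discToStrip_zero : discToStrip 0 = 0 := by simp [discToStrip]

theorem one_sub_ne_zero_of_mem_ball {z : ℂ} (hz : z ∈ ball (0 : ℂ) 1) : 1 - z ≠ 0 := by
  intro h
  rw [mem_ball_zero_iff, ← sub_eq_zero.1 h, norm_one] at hz
  exact lt_irrefl _ hz

theorem cayley_re_pos {z : ℂ} (hz : z ∈ ball (0 : ℂ) 1) : 0 < ((1 + z) / (1 - z)).re := by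
  have h1 := Complex.normSq_pos.2 (one_sub_ne_zero_of_mem_ball hz)
  rw [mem_ball_zero_iff, ← sq_lt_one_iff₀ (norm_nonneg _), Complex.sq_norm,
    Complex.normSq_apply] at hz
  rw [Complex.div_re, ← add_div]
  refine div_pos ?_ h1
  simp only [Complex.sub_re, Complex.sub_im, Complex.add_re, Complex.add_im, Complex.one_re,
    Complex.one_im]
  nlinarith

theorem abs_im_discToStrip_lt {z : ℂ} (hz : z ∈ ball (0 : ℂ) 1) :
    |(discToStrip z).im| < Real.pi / 2 := by
  rw [discToStrip, Complex.log_im, Complex.abs_arg_lt_pi_div_two_iff]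
  exact Or.inl (cayley_re_pos hz)

theorem differentiableAt_discToStrip {z : ℂ} (hz : z ∈ ball (0 : ℂ) 1) :
    DifferentiableAt ℂ discToStrip z :=
  ((differentiableAt_id.const_add 1).div (differentiableAt_id.const_sub 1)
    (one_sub_ne_zero_of_mem_ball hz)).clog (Or.inl (cayley_re_pos hz))

theorem stripToDisc_discToStrip {z : ℂ} (hz : z ∈ ball (0 : ℂ) 1) :
    stripToDisc (discToStrip z) = z := by
  have h1 := one_sub_ne_zero_of_mem_ball hz
  have h2 : (1 + z) / (1 - z) ≠ 0 := fun h => by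
    have := cayley_re_pos hz
    rw [h] at this
    exact lt_irrefl _ this
  rw [stripToDisc, discToStrip, Complex.exp_log h2]
  field_simp
  ring_nf

/-- A quantitative Hurwitz theorem: a function that is uniformly close to a function `F`
takes the values close to `F 0`. -/
theorem exists_eq_of_close {F G : ℂ → ℂ} {ρ ε : ℝ} (hρ : 0 < ρ)
    (hF : ∀ z ∈ sphere (0 : ℂ) ρ, ε ≤ ‖F z - F 0‖)
    (hG : DifferentiableOn ℂ G (closedBall 0 ρ)) (hG0 : deriv G 0 ≠ 0)
    (hFG : ∀ z ∈ closedBall (0 : ℂ) ρ, dist (F z) (G z) < ε / 8) {v : ℂ}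
    (hv : dist v (F 0) < ε / 8) : ∃ ξ ∈ closedBall (0 : ℂ) ρ, G ξ = v := by
  have hGd : DifferentiableAt ℂ G 0 :=
    hG.differentiableAt (closedBall_mem_nhds 0 hρ)
  have h0 := hFG 0 (mem_closedBall_self hρ.le)
  -- On the sphere `‖G z - G 0‖ ≥ ε - 2 * (ε / 8) ≥ ε / 2`, so the open mapping theorem covers the
  -- ball of radius `ε / 4` about `G 0`, and `v` is within `ε / 8 + ε / 8` of `G 0`.
  have hsub := (hG.diffContOnCl_ball Subset.rfl).ball_subset_image_closedBall
    (ε := ε / 2) hρ (fun z hz => ?_)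
    (((hGd.hasDerivAt.eventually_ne hG0).frequently).filter_mono nhdsWithin_le_nhds)
  · refine hsub ?_
    rw [mem_ball]
    linarith [dist_triangle v (F 0) (G 0)]
  · have h1 := hF z hz
    have h2 := hFG z (sphere_subset_closedBall hz)
    rw [← dist_eq_norm] at h1 ⊢
    have h3 := dist_triangle4 (F z) (G z) (G 0) (F 0)
    rw [dist_comm (G 0)] at h3
    have h4 := dist_nonneg.trans_lt hv
    linarith

/-! ### Persistence of discs, and the theorem. -/

namespace RiemannSurfaceLamination

variable {X : Type u} [TopologicalSpace X] {L : RiemannSurfaceLamination.{u, v, w} X}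

/-- A disc in a leaf deforms to the nearby leaves, over any smaller concentric disc. -/
theorem deforms_disc {Y : Type*} {l : Filter Y} {f : ℂ → X} {a₀ : L.ι} {τ : Y → L.T a₀}
    (hf : ∀ ζ ∈ ball (0 : ℂ) 1, L.HolAt f ζ)
    (hf0 : f 0 ∈ (L.box a₀).source) (hcrit : ¬ L.IsCritical f 0)
    (hτ : Tendsto τ l (𝓝 (L.box a₀ (f 0)).2)) {R : ℝ} (hR : R < 1) :
    L.Deforms l f a₀ τ (closedBall 0 R) := by
  have hb0 : (0 : ℂ) ∈ ball (0 : ℂ) 1 := mem_ball_self one_pos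
  have hRb : closedBall (0 : ℂ) R ⊆ ball 0 1 := closedBall_subset_ball hR
  have hcont : ContinuousOn discToStrip (ball 0 1) := fun z hz =>
    (differentiableAt_discToStrip hz).continuousAt.continuousWithinAt
  have hK : IsCompact (discToStrip '' closedBall (0 : ℂ) R) :=
    (isCompact_closedBall _ _).image_of_continuousOn (hcont.mono hRb)
  obtain ⟨M, hM0, hM⟩ : ∃ M > 0, ∀ z ∈ closedBall (0 : ℂ) R, |(discToStrip z).re| ≤ M := by
    obtain ⟨M, hM⟩ := hK.isBounded.exists_norm_le
    exact ⟨max M 1, lt_max_of_lt_right one_pos, fun z hz =>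
      (Complex.abs_re_le_norm _).trans ((hM _ (mem_image_of_mem _ hz)).trans (le_max_left _ _))⟩
  obtain ⟨N, hN0, hNπ, hN⟩ : ∃ N > 0, N < Real.pi / 2 ∧
      ∀ z ∈ closedBall (0 : ℂ) R, |(discToStrip z).im| ≤ N := by
    rcases (closedBall (0 : ℂ) R).eq_empty_or_nonempty with h | h
    · exact ⟨1, one_pos, by linarith [Real.pi_gt_three], fun z hz => absurd hz (by simp [h])⟩
    · obtain ⟨z, hz, hzm⟩ := (isCompact_closedBall (0 : ℂ) R).exists_isMaxOn h
        ((Complex.continuous_im.comp_continuousOn (hcont.mono hRb)).abs)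
      refine ⟨max |(discToStrip z).im| 1, lt_max_of_lt_right one_pos,
        max_lt (abs_im_discToStrip_lt (hRb hz)) (by linarith [Real.pi_gt_three]),
        fun w hw => (hzm hw).trans (le_max_left _ _)⟩
  have hfs : ∀ ζ : ℂ, |ζ.im| < Real.pi / 2 → L.HolAt (fun w => f (stripToDisc w)) ζ :=
    fun ζ hζ => (hf _ (stripToDisc_mem_ball hζ)).comp (differentiableAt_stripToDisc hζ)
  have hf0' : f (stripToDisc 0) ∈ (L.box a₀).source := by rwa [stripToDisc_zero]
  have hs0 : |(0 : ℂ).im| < Real.pi / 2 := by simp [Real.pi_pos]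
  have hcrit' : ¬ L.IsCritical (fun w => f (stripToDisc w)) 0 := by
    intro h
    have h1 := deriv_eq_zero_of_isCritical (hfs 0 hs0) h hf0'
    refine hcrit ⟨a₀, hf0, ?_⟩
    have h2 : (fun w => (L.box a₀ (f w)).1) =ᶠ[𝓝 0]
        (fun w => (L.box a₀ (f (stripToDisc w))).1) ∘ discToStrip := by
      filter_upwards [isOpen_ball.mem_nhds hb0] with w hw
      simp only [Function.comp, stripToDisc_discToStrip hw]
    rw [h2.deriv_eq, deriv_comp, discToStrip_zero, h1, zero_mul]
    · rw [discToStrip_zero]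
      exact (hfs 0 hs0 a₀ hf0').2
    · exact differentiableAt_discToStrip hb0
  obtain ⟨U, hU, hKU, h, H, htag⟩ := deforms_rectangle (f := fun w => f (stripToDisc w)) hfs hf0'
    hcrit' (l := l) (τ := τ) (by rwa [stripToDisc_zero]) hM0 hN0 hNπ
  have hVo : IsOpen (ball 0 1 ∩ discToStrip ⁻¹' U) := hcont.isOpen_inter_preimage isOpen_ball hU
  refine ⟨ball 0 1 ∩ discToStrip ⁻¹' U, hVo, fun z hz => ⟨hRb hz, hKU
    ⟨abs_le.1 (hM z hz), abs_le.1 (hN z hz)⟩⟩, fun y z => h y (discToStrip z), ⟨?_, ?_⟩, ?_⟩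
  · filter_upwards [H.holAt] with y hy ζ hζ
    exact (hy _ hζ.2).comp (differentiableAt_discToStrip hζ.1)
  · intro ζ hζ
    have h1 := (H.tendsto _ hζ.2).comp ((tendsto_fst (f := l) (g := 𝓝 ζ)).prodMk
      ((differentiableAt_discToStrip hζ.1).continuousAt.tendsto.comp tendsto_snd))
    rwa [stripToDisc_discToStrip hζ.1] at h1
  · filter_upwards [htag] with y hy
    rwa [discToStrip_zero]

namespace LeafMetric

variable (g : L.LeafMetric)

/-- Discs in nearby leaves have almost the same speed. -/
theorem eventually_exists_disc_lt_speed {x : X} {f : ℂ → X} (hf : f ∈ L.discs x) {s : ℝ}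
    (hs : 0 ≤ s) (hsf : s < g.speed f 0) : ∀ᶠ y in 𝓝 x, ∃ k ∈ L.discs y, s < g.speed k 0 := by
  obtain ⟨hf, rfl⟩ := hf
  obtain ⟨a, ha⟩ := L.cover (f 0)
  have hb0 : (0 : ℂ) ∈ ball (0 : ℂ) 1 := mem_ball_self one_pos
  have hhol : ∀ ζ ∈ ball (0 : ℂ) 1, L.HolAt f ζ := fun ζ hζ => hf.holAt hζ
  set F : ℂ → ℂ := fun w => (L.box a (f w)).1 with hF
  set κ := g.density a (f 0) with hκ
  have hκ0 : 0 < κ := g.density_pos a _ ha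
  rw [g.speed_eq hf hb0 ha] at hsf
  change s < ‖deriv F 0‖ * κ at hsf
  have hF0 : 0 < ‖deriv F 0‖ := by
    by_contra! h
    nlinarith
  have hcrit : ¬ L.IsCritical f 0 := fun h =>
    (norm_pos_iff.1 hF0) (deriv_eq_zero_of_isCritical (hhol 0 hb0) h ha)
  -- The gap between `s` and the speed pays for shrinking the disc by `r` and for lowering the
  -- derivative to `q`. The radius `(1 + r) / 2` of the deformed disc leaves room for the shift by
  -- `ξ`.
  obtain ⟨r, hr0, hr1, hrs⟩ : ∃ r, 0 < r ∧ r < 1 ∧ s < r * (‖deriv F 0‖ * κ) := by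
    have h1 : s / (‖deriv F 0‖ * κ) < 1 := (div_lt_one (by positivity)).2 hsf
    obtain ⟨r, h2, h3⟩ := exists_between h1
    exact ⟨r, (by positivity : 0 ≤ s / (‖deriv F 0‖ * κ)).trans_lt h2, h3,
      (div_lt_iff₀ (by positivity)).1 h2⟩
  obtain ⟨q, hqs, hqF⟩ : ∃ q, s < r * (q * κ) ∧ q < ‖deriv F 0‖ := by
    have h1 : s / (r * κ) < ‖deriv F 0‖ := by
      rw [div_lt_iff₀ (by positivity)]
      linarith
    obtain ⟨q, h2, h3⟩ := exists_between h1
    rw [div_lt_iff₀ (by positivity)] at h2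
    exact ⟨q, by linarith, h3⟩
  have hq0 : 0 < q := by
    by_contra! h
    have : q * κ ≤ 0 := mul_nonpos_of_nonpos_of_nonneg h hκ0.le
    nlinarith
  have hτ : Tendsto (fun y => (L.box a y).2) (𝓝 (f 0)) (𝓝 (L.box a (f 0)).2) :=
    (continuous_snd.tendsto _).comp ((L.box a).continuousAt ha).tendsto
  obtain ⟨U, hU, hRU, h, H, htag⟩ := deforms_disc hhol ha hcrit hτ
    (show (1 + r) / 2 < 1 by linarith)
  have h0U : (0 : ℂ) ∈ U := hRU (mem_closedBall_self (by linarith))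
  -- The part of the disc in the flow box
  set W := U ∩ {ζ ∈ ball (0 : ℂ) 1 | f ζ ∈ L.plaque a (L.box a (f 0)).2} with hW
  have hWo : IsOpen W := hU.inter (isOpen_setOf_mem_plaque isOpen_ball hhol _ _)
  have h0W : (0 : ℂ) ∈ W := ⟨h0U, hb0, ha, rfl⟩
  have hFd : DifferentiableOn ℂ F W := fun ζ hζ =>
    (hhol ζ hζ.2.1 a hζ.2.2.1).2.differentiableWithinAt
  have hFd0 := hFd.differentiableAt (hWo.mem_nhds h0W)
  obtain ⟨q', hqq', hq'F⟩ := exists_between hqF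
  have hne : ∀ᶠ z in 𝓝 (0 : ℂ), z ≠ 0 → F z ≠ F 0 :=
    eventually_nhdsWithin_iff.1 (hFd0.hasDerivAt.eventually_ne (norm_pos_iff.1 hF0))
  have hdF : ∀ᶠ z in 𝓝 (0 : ℂ), q' < ‖deriv F z‖ :=
    (((hFd.deriv hWo).differentiableAt (hWo.mem_nhds h0W)).continuousAt.norm.eventually
      (lt_mem_nhds hq'F))
  obtain ⟨ρ₁, hρ₁, hρ₁W⟩ := Metric.eventually_nhds_iff_ball.1
    ((hWo.eventually_mem h0W).and (hne.and hdF))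
  obtain ⟨ρ, hρ, hρ₁', hρr⟩ : ∃ ρ > 0, ρ < ρ₁ ∧ ρ + r < (1 + r) / 2 := by
    refine ⟨min (ρ₁ / 2) ((1 - r) / 4), lt_min (half_pos hρ₁) (by linarith), ?_, ?_⟩
    · linarith [min_le_left (ρ₁ / 2) ((1 - r) / 4)]
    · linarith [min_le_right (ρ₁ / 2) ((1 - r) / 4)]
  have hBall : closedBall (0 : ℂ) ρ ⊆ ball 0 ρ₁ := closedBall_subset_ball hρ₁'
  have hBW : ball (0 : ℂ) ρ₁ ⊆ W := fun z hz => (hρ₁W z hz).1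
  obtain ⟨ε, hε, hεF⟩ : ∃ ε > 0, ∀ z ∈ sphere (0 : ℂ) ρ, ε ≤ ‖F z - F 0‖ := by
    obtain ⟨z, hz, hzm⟩ := (isCompact_sphere (0 : ℂ) ρ).exists_isMinOn
      (NormedSpace.sphere_nonempty.2 hρ.le) (f := fun z => ‖F z - F 0‖)
      ((hFd.continuousOn.mono ((sphere_subset_closedBall.trans hBall).trans hBW)).sub
        continuousOn_const).norm
    refine ⟨‖F z - F 0‖, norm_pos_iff.2 (sub_ne_zero.2 ?_), fun w hw => hzm hw⟩
    refine (hρ₁W z (hBall (sphere_subset_closedBall hz))).2.1 fun h => ?_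
    rw [h, mem_sphere, dist_self] at hz
    exact hρ.ne hz
  -- Convergence in the flow box
  obtain ⟨ρ₂, hρρ₂, hρ₂⟩ := exists_between hρ₁'
  have hB₂ : ball (0 : ℂ) ρ₂ ⊆ W := (ball_subset_ball hρ₂.le).trans hBW
  have hBρ : closedBall (0 : ℂ) ρ ⊆ ball 0 ρ₂ := closedBall_subset_ball hρρ₂
  have hsrc : ∀ᶠ y in 𝓝 (f 0), MapsTo (h y) (closedBall 0 ρ₂) (L.box a).source :=
    H.eventually_mapsTo (isCompact_closedBall _ _)
      (((closedBall_subset_ball hρ₂).trans hBW).trans inter_subset_left) (L.box a).open_source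
      fun ζ hζ => (hBW (closedBall_subset_ball hρ₂ hζ)).2.2.1
  have hloc := (H.mono (hB₂.trans inter_subset_left)).tendstoLocallyUniformlyOn
    (fun ζ hζ => hhol ζ (hB₂ hζ).2.1) (a := a) fun ζ hζ => (hB₂ hζ).2.2.1
  have hGd : ∀ᶠ y in 𝓝 (f 0), DifferentiableOn ℂ (fun w => (L.box a (h y w)).1) (ball 0 ρ₂) := by
    filter_upwards [H.holAt, hsrc] with y hy hs ζ hζ
    exact (hy ζ (hB₂ hζ).1 a (hs (ball_subset_closedBall hζ))).2.differentiableWithinAt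
  have hclose := Metric.tendstoUniformlyOn_iff.1
    ((tendstoLocallyUniformlyOn_iff_forall_isCompact isOpen_ball).1 hloc _ hBρ
      (isCompact_closedBall _ _)) (ε / 8) (by positivity)
  have hderiv := Metric.tendstoUniformlyOn_iff.1
    ((tendstoLocallyUniformlyOn_iff_forall_isCompact isOpen_ball).1
      (hloc.deriv hGd isOpen_ball) _ hBρ (isCompact_closedBall _ _)) (q' - q) (by linarith)
  have hdens : ∀ᶠ y in 𝓝 (f 0), s < r * (q * g.density a y) :=
    ((((g.continuousOn a).continuousAt ((L.box a).open_source.mem_nhds ha)).const_mul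
      q).const_mul r).eventually (lt_mem_nhds hqs)
  have hval : ∀ᶠ y in 𝓝 (f 0), dist (L.box a y).1 (F 0) < ε / 8 :=
    ((continuous_fst.tendsto _).comp ((L.box a).continuousAt ha).tendsto).eventually
      (ball_mem_nhds _ (by positivity))
  filter_upwards [H.holAt, htag, hsrc, hGd, hclose, hderiv, hdens, hval,
    (L.box a).open_source.mem_nhds ha] with y hyhol hytag hysrc hyGd hyclose hyderiv hydens
    hyval hya
  set G : ℂ → ℂ := fun w => (L.box a (h y w)).1 with hG
  -- The bound is needed on the whole ball, since the new disc is centred at the still unknown point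
  -- `ξ` and not at `0`.
  have hGq : ∀ z ∈ closedBall (0 : ℂ) ρ, q < ‖deriv G z‖ := by
    intro z hz
    have h1 : q' < ‖deriv F z‖ := (hρ₁W z (hBall hz)).2.2
    have h2 : dist (deriv F z) (deriv G z) < q' - q := hyderiv z hz
    rw [dist_eq_norm] at h2
    linarith [norm_sub_norm_le (deriv F z) (deriv G z)]
  obtain ⟨ξ, hξ, hξy⟩ := exists_eq_of_close hρ hεF (hyGd.mono hBρ)
    (norm_pos_iff.1 (hq0.trans (hGq 0 (mem_closedBall_self hρ.le)))) hyclose hyval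
  have hξs : h y ξ ∈ (L.box a).source := hysrc (ball_subset_closedBall (hBρ hξ))
  -- Hurwitz matches the leaf coordinates. The transverse ones agree because `h y` maps the ball
  -- into a single plaque and `h y 0` lies in the plaque of `y`.
  have hξ' : h y ξ = y := by
    refine (L.box a).injOn hξs hya (Prod.ext hξy ?_)
    rw [← hytag.2]
    exact snd_box_eq_of_isPreconnected (convex_closedBall (0 : ℂ) ρ).isPreconnected
      (fun z hz => hyhol z (hB₂ (hBρ hz)).1)
      (fun z hz => hysrc (ball_subset_closedBall (hBρ hz))) hξ (mem_closedBall_self hρ.le)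
  have hmem : (fun z => h y (ξ + r * z)) ∈ L.discs y := by
    refine mem_discs_of_holAt (fun ζ hζ => ?_) (by simpa using hξ')
    refine HolAt.comp (α := fun z => ξ + r * z) (hyhol _ (hRU ?_)) (by fun_prop)
    rw [mem_closedBall_zero_iff] at hξ ⊢
    rw [mem_ball_zero_iff] at hζ
    have h1 := norm_add_le ξ (r * ζ)
    rw [norm_mul, Complex.norm_real, Real.norm_of_nonneg hr0.le] at h1
    nlinarith
  refine ⟨_, hmem, ?_⟩
  have hk0 : h y (ξ + r * 0) = y := by simpa using hξ'
  rw [g.speed_eq hmem.1 hb0 (b := a) (by rwa [hk0]), hk0]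
  have hd : HasDerivAt (fun z => G (ξ + r * z)) (deriv G ξ * r) 0 := by
    have h1 : HasDerivAt (fun z : ℂ => ξ + r * z) (r : ℂ) 0 := by
      simpa using ((hasDerivAt_id (0 : ℂ)).const_mul (r : ℂ)).const_add ξ
    have h2 : HasDerivAt G (deriv G ξ) (ξ + r * 0) := by
      rw [mul_zero, add_zero]
      exact (hyGd.differentiableAt (isOpen_ball.mem_nhds (hBρ hξ))).hasDerivAt
    exact h2.comp (0 : ℂ) h1
  change s < ‖deriv (fun z => G (ξ + r * z)) 0‖ * g.density a y
  rw [hd.deriv, norm_mul, Complex.norm_real, Real.norm_of_nonneg hr0.le]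
  have h1 := mul_lt_mul_of_pos_right (hGq ξ hξ) (mul_pos hr0 (g.density_pos a y hya))
  linarith

/-- An affine disc about `z₀` of radius `1 - ‖z₀‖`, inside the plaque through `x`, makes the
supremum positive and hence its inverse finite. -/
theorem exists_disc_speed_pos (x : X) : ∃ f ∈ L.discs x, 0 < g.speed f 0 := by
  obtain ⟨a, ha⟩ := L.cover x
  have hz := box_fst_mem_ball ha
  rw [mem_ball_zero_iff] at hz
  set z₀ := (L.box a x).1
  set r := 1 - ‖z₀‖ with hr
  have hr0 : 0 < r := by linarith
  have hmemb : ∀ ζ ∈ ball (0 : ℂ) 1, z₀ + r * ζ ∈ ball (0 : ℂ) 1 := by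
    intro ζ hζ
    rw [mem_ball_zero_iff] at hζ ⊢
    have h1 := norm_add_le z₀ (r * ζ)
    rw [norm_mul, Complex.norm_real, Real.norm_of_nonneg hr0.le] at h1
    nlinarith
  have hb0 : (0 : ℂ) ∈ ball (0 : ℂ) 1 := mem_ball_self one_pos
  have h0 : (L.box a).symm (z₀ + r * 0, (L.box a x).2) = x := by
    simpa using (L.box a).left_inv ha
  have hmem : (fun ζ : ℂ => (L.box a).symm (z₀ + r * ζ, (L.box a x).2)) ∈ L.discs x :=
    mem_discs_of_holAt (fun ζ hζ => holAt_box_symm _ (by fun_prop) (hmemb ζ hζ)) h0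
  refine ⟨_, hmem, ?_⟩
  rw [g.speed_eq hmem.1 hb0 (b := a) (by rwa [h0]), h0]
  refine mul_pos (norm_pos_iff.2 ?_) (g.density_pos a x ha)
  have heq : (fun w : ℂ => (L.box a ((L.box a).symm (z₀ + r * w, (L.box a x).2))).1) =ᶠ[𝓝 0]
      fun w => z₀ + r * w := by
    filter_upwards [isOpen_ball.mem_nhds hb0] with w hw
    rw [(L.box a).right_inv (mem_box_target (hmemb w hw) _)]
  have hd : HasDerivAt (fun z : ℂ => z₀ + r * z) (r : ℂ) 0 := by
    simpa using ((hasDerivAt_id (0 : ℂ)).const_mul (r : ℂ)).const_add z₀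
  rw [heq.deriv_eq, hd.deriv]
  exact_mod_cast hr0.ne'

end LeafMetric

end RiemannSurfaceLamination

/-- On every Riemann surface lamination with a continuous leafwise hermitian metric, the leafwise
Kobayashi metric is finite-valued and upper semicontinuous. -/
theorem theorem2p2 {X : Type u} [TopologicalSpace X] (L : RiemannSurfaceLamination.{u, v, w} X)
    (g : L.LeafMetric) :
    (∀ x, g.kobayashi x ≠ ⊤) ∧ UpperSemicontinuous g.kobayashi := by
  constructor
  · intro x
    obtain ⟨f, hf, h0⟩ := g.exists_disc_speed_pos x
    rw [RiemannSurfaceLamination.LeafMetric.kobayashi, Ne, ENNReal.inv_eq_top]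
    refine ((ENNReal.ofReal_pos.2 h0).trans_le ?_).ne'
    exact le_iSup₂ (f := fun f _ => ENNReal.ofReal (g.speed f 0)) f hf
  · intro x c hc
    -- Inversion turns the upper bound `c` on the metric into a lower bound `c⁻¹` on the supremum,
    -- which a single disc already exceeds.
    rw [RiemannSurfaceLamination.LeafMetric.kobayashi, ENNReal.inv_lt_iff_inv_lt, lt_iSup_iff] at hc
    obtain ⟨f, hc⟩ := hc
    obtain ⟨hf, hc⟩ := lt_iSup_iff.1 hc
    have htop : c⁻¹ ≠ ⊤ := (hc.trans ENNReal.ofReal_lt_top).ne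
    filter_upwards [g.eventually_exists_disc_lt_speed hf ENNReal.toReal_nonneg
      ((ENNReal.lt_ofReal_iff_toReal_lt htop).1 hc)] with y ⟨k, hk, hky⟩
    rw [RiemannSurfaceLamination.LeafMetric.kobayashi, ENNReal.inv_lt_iff_inv_lt]
    exact ((ENNReal.lt_ofReal_iff_toReal_lt htop).2 hky).trans_le
      (le_iSup₂ (f := fun f _ => ENNReal.ofReal (g.speed f 0)) k hk)
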